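/- **Theorem 3.** Let $\xi_1,\xi_2,\dots$ be i.i.d. random variables, uniformly distributed on $(0,1)$, with order statistics $\xi_{n1}\le\dots\le\xi_{nn}$ of the first $n$ of them. *Kernel and bandwidth.* Let $k$ be a bounded probability density on $\mathbb R$ with zero mean and finite variance whose distribution function $K(x)=\int_{-\infty}^x k$ is differentiable, and let $b=b_n>0$ satisfy $b_n\to0$ and $nb_n\to\infty$. Put $$F_{n,b}(t)=\frac1{nb_n}\sum_{i=1}^n\int_{-\infty}^t k\Big(\frac{y-\xi_i}{b_n}\Big)\,dy,\qquad F_{n,b}^{-1}(u)=\inf\{t: F_{n,b}(t)\ge u\}.$$ *Scores.* Let $c_{n1},\dots,c_{nn}$ ($n\ge1$) be real constants and let $J_n(t)=c_{ni}$ for $(i-1)/n<t\le i/n$, $1\le i\le n$, and $J_n(0)=c_{n1}$. Let $J$ be a measurable function on $(0,1)$. Let $g$ be a left continuous function on $(0,1)$ that is of bounded variation on $(\theta,1-\theta)$ for every $\theta\in(0,1/2)$, and let $d|g|$ be its total variation measure on $(0,1)$. *Boundedness.* For some constants $b_1,b_2,M,\delta>0$ let, for $0<t<1$, $$B(t)=Mt^{-b_1}(1-t)^{-b_2},\quad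 D(t)=Mt^{-1+b_1+\delta}(1-t)^{-1+b_2+\delta},\quad h(t)=[t(1-t)]^{1-\delta/2},$$ and suppose that $|g|\le D$, $|J_n|\le B$ for all $n\ge1$, and $|J|\le B$ on $(0,1)$, and that $\int_0^1 B\,h\,d|g|<\infty$. Define $$T_n=\int_0^1 g\big(F_{n,b}^{-1}(u)\big)J_n(u)\,du,\qquad T_n'=\frac1n\sum_{i=1}^n g(\xi_{ni})\,c_{ni},\qquad \mu_n=\int_0^1 g(t)J_n(t)\,dt,$$ where $g(x)$ is read as $0$ for $x\notin(0,1)$. Then the integral $\mu_n$ exists for all $n\ge1$, almost surely the integral $T_n$ exists for all $n\ge1$, and $$\lim_{n\to\infty}(T_n-\mu_n)=0\quad\text{and}\quad \lim_{n\to\infty}(T_n'-\mu_n)=0\qquad\text{almost surely.}$$ -/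

import Mathlib

open MeasureTheory ProbabilityTheory Filter Set
open scoped Topology ENNReal

noncomputable section

namespace LStat

/-! ### The kernel and the bandwidth -/

/-- The distribution function `K(x) = ∫_{-∞}^x k` of a kernel density `k`. -/
def kernelDF (k : ℝ → ℝ) (x : ℝ) : ℝ := ∫ t in Iic x, k t

/-- `k` is a bounded probability density with differentiable distribution function, zero mean and
finite variance. -/
structure IsKernel (k : ℝ → ℝ) : Prop where
  nonneg : ∀ x, 0 ≤ k x
  integrable : Integrable k
  integral_eq_one : ∫ x, k x = 1
  bounded : ∃ C, ∀ x, k x ≤ C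
  differentiable : Differentiable ℝ (kernelDF k)
  integrable_mean : Integrable fun x => x * k x
  mean_eq_zero : ∫ x, x * k x = 0
  integrable_variance : Integrable fun x => x ^ 2 * k x

/-- The smoothing parameters `b_n > 0` satisfy `b_n → 0` and `n b_n → ∞`. -/
structure IsBandwidth (b : ℕ → ℝ) : Prop where
  pos : ∀ n, 1 ≤ n → 0 < b n
  tendsto_zero : Tendsto b atTop (𝓝 0)
  tendsto_atTop : Tendsto (fun n : ℕ => (n : ℝ) * b n) atTop atTop

/-- The kernel estimator `F_{n,b}(t) = (1/(nb)) ∑_{i=1}^n ∫_{-∞}^t k((y - x_i)/b) dy` of the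
distribution function, computed from the first `n` terms `x 0, …, x (n-1)` of `x`. -/
def kernelEst (k : ℝ → ℝ) (b : ℝ) (n : ℕ) (x : ℕ → ℝ) (t : ℝ) : ℝ :=
  1 / ((n : ℝ) * b) * ∑ i ∈ Finset.range n, ∫ y in Iic t, k ((y - x i) / b)

/-- The left continuous inverse `H⁻¹(u) = inf {t : u ≤ H(t)}` of a distribution function. -/
def leftInv (H : ℝ → ℝ) (u : ℝ) : ℝ := sInf {t | u ≤ H t}

/-! ### Scores and the L-statistic -/

/-- The score function: `J_n(t) = c_{ni}` for `(i-1)/n < t ≤ i/n`, `1 ≤ i ≤ n`, and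
`J_n(0) = c_{n1}`. -/
def score (c : ℕ → ℕ → ℝ) (n : ℕ) (t : ℝ) : ℝ := c n (max 1 ⌈(n : ℝ) * t⌉₊)

/-- The integrand `g(F_{n,b}⁻¹(u)) J_n(u)` of `T_n`. The function `g` lives on `(0,1)` only, whereas
`F_{n,b}⁻¹(u)` can lie outside `(0,1)`; there `g` is read as `0`. -/
def integrandT (g k : ℝ → ℝ) (c : ℕ → ℕ → ℝ) (b : ℝ) (n : ℕ) (x : ℕ → ℝ) (u : ℝ) : ℝ :=
  (Ioo (0 : ℝ) 1).indicator g (leftInv (kernelEst k b n x) u) * score c n u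

/-- `T_n = ∫₀¹ g(F_{n,b}⁻¹(u)) J_n(u) du`. -/
def statT (g k : ℝ → ℝ) (c : ℕ → ℕ → ℝ) (b : ℝ) (n : ℕ) (x : ℕ → ℝ) : ℝ :=
  ∫ u in Ioo (0 : ℝ) 1, integrandT g k c b n x u

/-- The order statistics of `x 0, …, x (n-1)`, in increasing order. -/
def orderStat (n : ℕ) (x : ℕ → ℝ) (i : Fin n) : ℝ :=
  x (Tuple.sort (fun j : Fin n => x j) i)

/-- The linear function of order statistics `(1/n) ∑_{i=1}^n g(x_{ni}) c_{ni}`. -/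
def statOrder (g : ℝ → ℝ) (c : ℕ → ℕ → ℝ) (n : ℕ) (x : ℕ → ℝ) : ℝ :=
  1 / (n : ℝ) * ∑ i : Fin n, g (orderStat n x i) * c n ((i : ℕ) + 1)

/-- `μ_n = ∫₀¹ g(t) J_n(t) dt`. -/
def centerMu (g : ℝ → ℝ) (c : ℕ → ℕ → ℝ) (n : ℕ) : ℝ :=
  ∫ t in Ioo (0 : ℝ) 1, g t * score c n t

/-! ### The class of functions `g` and the measure `d|g|` -/

/-- Left continuous functions on `(0,1)` that are of bounded variation on `(θ, 1-θ)` for all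
`θ ∈ (0,1/2)`. Values outside `(0,1)` play no role. -/
structure IsClassG (g : ℝ → ℝ) : Prop where
  leftCont : ∀ t ∈ Ioo (0 : ℝ) 1, ContinuousWithinAt g (Iic t) t
  bv : ∀ θ ∈ Ioo (0 : ℝ) (1 / 2), BoundedVariationOn g (Ioo θ (1 - θ))

theorem IsClassG.locallyBV {g : ℝ → ℝ} (hg : IsClassG g) :
    LocallyBoundedVariationOn g (Ioo 0 1) := by
  intro a b ha hb
  have h0 : (0 : ℝ) < min (min a (1 - b)) (1 / 2) / 2 := by
    have := ha.1
    have := hb.2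
    have h : (0 : ℝ) < min (min a (1 - b)) (1 / 2) :=
      lt_min (lt_min (by assumption) (by linarith)) (by norm_num)
    linarith
  have h1 : min (min a (1 - b)) (1 / 2) ≤ a := (min_le_left _ _).trans (min_le_left _ _)
  have h2 : min (min a (1 - b)) (1 / 2) ≤ 1 - b := (min_le_left _ _).trans (min_le_right _ _)
  have h3 : min (min a (1 - b)) (1 / 2) ≤ (1 / 2 : ℝ) := min_le_right _ _
  refine (hg.bv (min (min a (1 - b)) (1 / 2) / 2) ⟨h0, by linarith⟩).mono ?_
  rintro t ⟨-, hat, htb⟩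
  constructor <;> linarith

/-- The signed variation of `g` from `1/2` to `t ∈ (0,1)`. -/
def varFun (g : ℝ → ℝ) (t : Ioo (0 : ℝ) 1) : ℝ := variationOnFromTo g (Ioo 0 1) (1 / 2) t

theorem IsClassG.monotone_varFun {g : ℝ → ℝ} (hg : IsClassG g) : Monotone (varFun g) :=
  fun s t hst => variationOnFromTo.monotoneOn hg.locallyBV (by norm_num) s.2 t.2 hst

instance : CompactIccSpace (Ioo (0 : ℝ) 1) where
  isCompact_Icc {a b} := by
    rw [Subtype.isCompact_iff]
    have : (Subtype.val '' Icc a b : Set ℝ) = Icc (a : ℝ) b := by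
      ext t
      constructor
      · rintro ⟨s, hs, rfl⟩
        exact hs
      · intro ht
        exact ⟨⟨t, a.2.1.trans_le ht.1, ht.2.trans_lt b.2.2⟩, ht, rfl⟩
    rw [this]
    exact isCompact_Icc

/-- The total variation measure `d|g|` on `(0,1)`: the Stieltjes measure of the variation of `g`. -/
def IsClassG.varMeasure {g : ℝ → ℝ} (hg : IsClassG g) : Measure (Ioo (0 : ℝ) 1) :=
  hg.monotone_varFun.stieltjesFunction.measure

/-! ### The boundedness assumption -/

/-- `B(t) = M t^{-b₁} (1-t)^{-b₂}`. -/
def boundB (M b₁ b₂ t : ℝ) : ℝ := M * t ^ (-b₁) * (1 - t) ^ (-b₂)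

/-- `D(t) = M t^{-1+b₁+δ} (1-t)^{-1+b₂+δ}`. -/
def boundD (M b₁ b₂ δ t : ℝ) : ℝ := M * t ^ (-1 + b₁ + δ) * (1 - t) ^ (-1 + b₂ + δ)

/-- `h(t) = [t(1-t)]^{1-δ/2}`. -/
def weightH (δ t : ℝ) : ℝ := (t * (1 - t)) ^ (1 - δ / 2)

/-- On `(0,1)`: `|g| ≤ D`, `|J_n| ≤ B` for all `n ≥ 1`, `|J| ≤ B`, and `∫ B h d|g| < ∞`. -/
structure IsBounded (M b₁ b₂ δ : ℝ) (g : ℝ → ℝ) (hg : IsClassG g) (c : ℕ → ℕ → ℝ)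
    (J : Ioo (0 : ℝ) 1 → ℝ) : Prop where
  g_le : ∀ t ∈ Ioo (0 : ℝ) 1, |g t| ≤ boundD M b₁ b₂ δ t
  score_le : ∀ n, 1 ≤ n → ∀ t ∈ Ioo (0 : ℝ) 1, |score c n t| ≤ boundB M b₁ b₂ t
  J_le : ∀ t, |J t| ≤ boundB M b₁ b₂ t
  lintegral_lt_top :
    ∫⁻ t : Ioo (0 : ℝ) 1, ENNReal.ofReal (boundB M b₁ b₂ t * weightH δ t) ∂hg.varMeasure < ∞

end LStat

end

/-!
Let `ν` be the empirical measure of `x₁, …, xₙ` and `κ` the law of `b Z`, where `Z` has density `k`.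
The kernel estimator is the distribution function of `ν ∗ κ`, and `T'ₙ` is `Tₙ` for the degenerate
kernel `κ = δ₀`, so both limits are instances of one statement about the quantile function `Gₙ` of
`ν ∗ κₙ`, where `κₙ → δ₀`. That statement is `∫₀¹ |g (Gₙ u) - g u| |Jₙ u| du → 0`, and almost every
path satisfies it for two reasons.

* `Gₙ u → u`, and `f` can be approximated in `L¹` by continuous functions whose error is small also
  under `ν ∗ κₙ`, the image of Lebesgue measure under `Gₙ`: hence `∫₀¹ |f (Gₙ u) - f u| du → 0`. For
  `κₙ = δ₀` the error is controlled by the law of large numbers. For a kernel, `κₙ` has density at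
  most `C n`, and if `∫ W ^ q < ∞` with `q > 1` then the random variables `∫ W (ξᵢ + z) κₙ(dz)` are
  at most of order `n ^ (1 / q)`, so that a Chernoff bound together with Borel–Cantelli applies.
* A Chernoff bound for the tails of `ν` gives `Gₙ u ^ (1 + η) ≤ C (u + 1/n)` uniformly in `u`, and
  the same at the other endpoint. As `Jₙ` is constant on cells of length `1/n`, this turns
  `|g| ≤ D` and `|Jₙ| ≤ B` into `|g (Gₙ u) Jₙ u| ≤ K w (Gₙ u)` with `w t = [t (1 - t)] ^ (-s)` and
  `s < 1`. Applying the first point to `w` gives the uniform integrability needed to pass to the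
  limit.
-/

noncomputable section

namespace LStat

section Quantile

variable (μ : Measure ℝ) {u : ℝ}

theorem isLeast_leftInv_cdf (hu : u ∈ Ioo (0 : ℝ) 1) :
    IsLeast {t | u ≤ cdf μ t} (leftInv (cdf μ) u) := by
  obtain ⟨r, hr⟩ := ((tendsto_cdf_atBot μ).eventually_lt_const hu.1).exists
  obtain ⟨s, hs⟩ := ((tendsto_cdf_atTop μ).eventually_const_lt hu.2).exists
  have hne : {t | u ≤ cdf μ t}.Nonempty := ⟨s, hs.le⟩
  have hbdd : BddBelow {t | u ≤ cdf μ t} :=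
    ⟨r, fun t ht => ((monotone_cdf μ).reflect_lt (hr.trans_le ht)).le⟩
  refine ⟨?_, fun t ht => csInf_le hbdd ht⟩
  refine ge_of_tendsto (((cdf μ).right_continuous _).mono_left
    (nhdsWithin_mono _ Ioi_subset_Ici_self)) ?_
  filter_upwards [self_mem_nhdsWithin] with t ht
  obtain ⟨v, hv, hvt⟩ := exists_lt_of_csInf_lt hne ht
  exact hv.trans (monotone_cdf μ hvt.le)

theorem leftInv_cdf_le_iff (hu : u ∈ Ioo (0 : ℝ) 1) {t : ℝ} :
    leftInv (cdf μ) u ≤ t ↔ u ≤ cdf μ t :=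
  ⟨fun h => (isLeast_leftInv_cdf μ hu).1.trans (monotone_cdf μ h),
    fun h => (isLeast_leftInv_cdf μ hu).2 h⟩

theorem monotoneOn_leftInv_cdf : MonotoneOn (leftInv (cdf μ)) (Ioo 0 1) := fun _ hu _ hv huv =>
  (leftInv_cdf_le_iff μ hu).2 (huv.trans (isLeast_leftInv_cdf μ hv).1)

theorem aemeasurable_leftInv_cdf :
    AEMeasurable (leftInv (cdf μ)) (volume.restrict (Ioo 0 1)) :=
  aemeasurable_restrict_of_monotoneOn measurableSet_Ioo (monotoneOn_leftInv_cdf μ)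

variable [IsProbabilityMeasure μ]

theorem map_leftInv_cdf : (volume.restrict (Ioo 0 1)).map (leftInv (cdf μ)) = μ := by
  refine Measure.ext_of_Iic _ _ fun t => ?_
  have hset : leftInv (cdf μ) ⁻¹' Iic t ∩ Ioo 0 1 = Iic (cdf μ t) ∩ Ioo 0 1 := by
    ext u
    exact and_congr_left fun hu => leftInv_cdf_le_iff μ hu
  rw [Measure.map_apply_of_aemeasurable (aemeasurable_leftInv_cdf μ) measurableSet_Iic,
    Measure.restrict_apply₀' measurableSet_Ioo.nullMeasurableSet, hset, ← ofReal_cdf]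
  apply le_antisymm
  · calc volume (Iic (cdf μ t) ∩ Ioo 0 1) ≤ volume (Ioc 0 (cdf μ t)) :=
          measure_mono fun u hu => ⟨hu.2.1, hu.1⟩
      _ = ENNReal.ofReal (cdf μ t) := by simp
  · calc ENNReal.ofReal (cdf μ t) = volume (Ioo 0 (cdf μ t)) := by simp
      _ ≤ volume (Iic (cdf μ t) ∩ Ioo 0 1) :=
          measure_mono fun u hu => ⟨hu.2.le, hu.1, hu.2.trans_le (cdf_le_one μ t)⟩

theorem lintegral_comp_leftInv_cdf {f : ℝ → ℝ≥0∞} (hf : Measurable f) :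
    ∫⁻ u in Ioo 0 1, f (leftInv (cdf μ) u) = ∫⁻ t, f t ∂μ := by
  rw [← lintegral_map' hf.aemeasurable (aemeasurable_leftInv_cdf μ), map_leftInv_cdf]

theorem measureReal_eq_preimage_leftInv_cdf {s : Set ℝ} (hs : MeasurableSet s) :
    μ.real s = volume.real (leftInv (cdf μ) ⁻¹' s ∩ Ioo 0 1) := by
  conv_lhs => rw [← map_leftInv_cdf μ]
  rw [measureReal_def, Measure.map_apply_of_aemeasurable (aemeasurable_leftInv_cdf μ) hs,
    Measure.restrict_apply₀' measurableSet_Ioo.nullMeasurableSet, measureReal_def]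

theorem measureReal_Iio_leftInv_cdf_le (hu : u ∈ Ioo (0 : ℝ) 1) :
    μ.real (Iio (leftInv (cdf μ) u)) ≤ u := by
  rw [measureReal_eq_preimage_leftInv_cdf μ measurableSet_Iio]
  calc volume.real (leftInv (cdf μ) ⁻¹' Iio (leftInv (cdf μ) u) ∩ Ioo 0 1)
      ≤ volume.real (Ioo 0 u) := measureReal_mono (fun v hv =>
        ⟨hv.2.1, (monotoneOn_leftInv_cdf μ).reflect_lt hv.2 hu hv.1⟩) measure_Ioo_lt_top.ne
    _ = u := by simp [hu.1.le]

theorem measureReal_Ioi_leftInv_cdf_le (hu : u ∈ Ioo (0 : ℝ) 1) :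
    μ.real (Ioi (leftInv (cdf μ) u)) ≤ 1 - u := by
  rw [measureReal_eq_preimage_leftInv_cdf μ measurableSet_Ioi]
  calc volume.real (leftInv (cdf μ) ⁻¹' Ioi (leftInv (cdf μ) u) ∩ Ioo 0 1)
      ≤ volume.real (Ioo u 1) := measureReal_mono (fun v hv =>
        ⟨(monotoneOn_leftInv_cdf μ).reflect_lt hu hv.2 hv.1, hv.2.2⟩) measure_Ioo_lt_top.ne
    _ = 1 - u := by simp [hu.2.le]

end Quantile

section EmpiricalMeasure

/-- The empirical measure of `x 0, …, x (n-1)`. It is a probability measure for `n ≠ 0`, and the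
zero measure for `n = 0`. -/
def empMeasure (n : ℕ) (x : ℕ → ℝ) : Measure ℝ :=
  (n : ℝ≥0∞)⁻¹ • ∑ i ∈ Finset.range n, Measure.dirac (x i)

variable (n : ℕ) (x : ℕ → ℝ)

instance [NeZero n] : IsProbabilityMeasure (empMeasure n x) :=
  ⟨by simp [empMeasure, ENNReal.inv_mul_cancel (NeZero.ne (n : ℝ≥0∞)) (ENNReal.natCast_ne_top n)]⟩

instance : IsFiniteMeasure (empMeasure n x) := by
  rcases eq_zero_or_neZero n with rfl | hn
  · simpa [empMeasure] using (inferInstance : IsFiniteMeasure (0 : Measure ℝ))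
  · infer_instance

theorem lintegral_empMeasure (f : ℝ → ℝ≥0∞) :
    ∫⁻ t, f t ∂empMeasure n x = (n : ℝ≥0∞)⁻¹ * ∑ i ∈ Finset.range n, f (x i) := by
  simp [empMeasure, lintegral_finsetSum_measure]

theorem integrable_empMeasure (f : ℝ → ℝ) : Integrable f (empMeasure n x) := by
  rcases eq_zero_or_neZero n with rfl | hn
  · simp [empMeasure]
  · exact (integrable_finsetSum_measure.2 fun i _ => integrable_dirac (by simp)).smul_measure
      (ENNReal.inv_ne_top.2 (NeZero.ne (n : ℝ≥0∞)))

theorem integral_empMeasure (f : ℝ → ℝ) :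
    ∫ t, f t ∂empMeasure n x = (n : ℝ)⁻¹ * ∑ i ∈ Finset.range n, f (x i) := by
  simp [empMeasure, integral_finsetSum_measure, integrable_dirac]

theorem measureReal_empMeasure_conv {κ : Measure ℝ} [IsFiniteMeasure κ] {s : Set ℝ}
    (hs : MeasurableSet s) :
    (empMeasure n x ∗ κ).real s = (n : ℝ)⁻¹ * ∑ i ∈ Finset.range n, κ.real {z | x i + z ∈ s} := by
  have h : (empMeasure n x ∗ κ) s = (n : ℝ≥0∞)⁻¹ * ∑ i ∈ Finset.range n, κ {z | x i + z ∈ s} := by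
    rw [← lintegral_indicator_one hs, Measure.lintegral_conv (measurable_one.indicator hs),
      lintegral_empMeasure]
    refine congrArg _ (Finset.sum_congr rfl fun i _ => ?_)
    exact lintegral_indicator_one (hs.preimage (measurable_const_add (x i)))
  rw [measureReal_def, h, ENNReal.toReal_mul,
    ENNReal.toReal_sum fun i _ => measure_ne_top κ {z | x i + z ∈ s}]
  simp [measureReal_def]

end EmpiricalMeasure

section Convolution

theorem measureReal_mul_le_conv {μ κ : Measure ℝ} [IsFiniteMeasure μ] [IsFiniteMeasure κ]
    {s t v : Set ℝ} (h : ∀ a ∈ s, ∀ z ∈ t, a + z ∈ v) : μ.real s * κ.real t ≤ (μ ∗ κ).real v := by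
  have hle : μ s * κ t ≤ (μ ∗ κ) v := by
    rw [← Measure.prod_prod]
    exact (measure_mono fun p hp => h p.1 hp.1 p.2 hp.2).trans
      (Measure.le_map_apply measurable_add.aemeasurable v)
  simpa [measureReal_def] using ENNReal.toReal_mono (measure_ne_top _ _) hle

theorem conv_le_smul_volume {μ κ : Measure ℝ} [IsProbabilityMeasure μ] [SFinite κ] {C : ℝ≥0∞}
    (h : κ ≤ C • volume) : μ ∗ κ ≤ C • volume := by
  refine Measure.le_iff.2 fun s hs => ?_
  rw [← lintegral_indicator_one hs, Measure.lintegral_conv (measurable_one.indicator hs)]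
  calc ∫⁻ a, ∫⁻ z, s.indicator 1 (a + z) ∂κ ∂μ
      ≤ ∫⁻ _, C * volume s ∂μ := lintegral_mono fun a => ?_
    _ = (C • volume) s := by simp
  calc ∫⁻ z, s.indicator 1 (a + z) ∂κ
      ≤ ∫⁻ z, s.indicator 1 (a + z) ∂(C • volume) := lintegral_mono' h le_rfl
    _ = C * volume s := by
      rw [lintegral_smul_measure, lintegral_add_left_eq_self, lintegral_indicator_one hs,
        smul_eq_mul]

end Convolution

section KernelLaw

/-- The law of `b * Z` for a random variable `Z` with density `k`. -/
def kernelLaw (k : ℝ → ℝ) (b : ℝ) : Measure ℝ :=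
  (volume.withDensity fun z => ENNReal.ofReal (k z)).map (b * ·)

variable {k : ℝ → ℝ} {b : ℝ}

theorem isProbabilityMeasure_withDensity_ofReal (hk0 : ∀ z, 0 ≤ k z)
    (hk1 : ∫ z, k z = 1) :
    IsProbabilityMeasure (volume.withDensity fun z => ENNReal.ofReal (k z)) :=
  ⟨by rw [withDensity_apply _ MeasurableSet.univ, setLIntegral_univ,
    ← ofReal_integral_eq_lintegral_ofReal (integrable_of_integral_eq_one hk1)
      (Eventually.of_forall hk0), hk1, ENNReal.ofReal_one]⟩

theorem isProbabilityMeasure_kernelLaw (hk0 : ∀ z, 0 ≤ k z) (hk1 : ∫ z, k z = 1) (b : ℝ) :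
    IsProbabilityMeasure (kernelLaw k b) :=
  have := isProbabilityMeasure_withDensity_ofReal hk0 hk1
  Measure.isProbabilityMeasure_map (measurable_const_mul b).aemeasurable

theorem measureReal_withDensity_Iic (hk0 : ∀ z, 0 ≤ k z) (hk : Integrable k) (r : ℝ) :
    (volume.withDensity fun z => ENNReal.ofReal (k z)).real (Iic r) = kernelDF k r := by
  rw [measureReal_def, withDensity_apply _ measurableSet_Iic,
    ← ofReal_integral_eq_lintegral_ofReal hk.integrableOn (Eventually.of_forall hk0),
    ENNReal.toReal_ofReal (integral_nonneg hk0), kernelDF]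

theorem measureReal_kernelLaw_Iic (hk0 : ∀ z, 0 ≤ k z) (hk : Integrable k) (hb : 0 < b) (r : ℝ) :
    (kernelLaw k b).real (Iic r) = kernelDF k (r / b) := by
  have hpre : (b * ·) ⁻¹' Iic r = Iic (r / b) := by
    ext z
    simp [le_div_iff₀' hb]
  rw [kernelLaw, map_measureReal_apply (measurable_const_mul b) measurableSet_Iic, hpre,
    measureReal_withDensity_Iic hk0 hk]

theorem kernelLaw_le_smul_volume {C : ℝ} (hC : ∀ z, k z ≤ C) (hb : 0 < b) :
    kernelLaw k b ≤ ENNReal.ofReal (C / b) • volume := by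
  calc kernelLaw k b ≤ (ENNReal.ofReal C • volume).map (b * ·) := by
        refine Measure.map_mono ?_ (measurable_const_mul b)
        rw [← withDensity_const]
        exact withDensity_mono (Eventually.of_forall fun z => ENNReal.ofReal_le_ofReal (hC z))
    _ = ENNReal.ofReal (C / b) • volume := by
        rw [Measure.map_smul, Real.map_volume_mul_left hb.ne', smul_smul,
          abs_of_pos (inv_pos.2 hb), ← ENNReal.ofReal_mul' (inv_nonneg.2 hb.le), div_eq_mul_inv]

theorem setIntegral_Iic_comp_sub_div (k : ℝ → ℝ) (hb : 0 < b) (x t : ℝ) :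
    ∫ y in Iic t, k ((y - x) / b) = b * kernelDF k ((t - x) / b) := by
  have h (y : ℝ) : (Iic t).indicator (fun y => k ((y - x) / b)) y =
      (Iic ((t - x) / b)).indicator k ((y - x) / b) := by
    simp only [indicator_apply, mem_Iic, div_le_div_iff_of_pos_right hb, sub_le_sub_iff_right]
  rw [← integral_indicator measurableSet_Iic, kernelDF, ← integral_indicator measurableSet_Iic]
  simp only [h]
  rw [integral_sub_right_eq_self (fun y => (Iic ((t - x) / b)).indicator k (y / b)) x,
    Measure.integral_comp_div, abs_of_pos hb, smul_eq_mul]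

theorem kernelEst_eq_cdf (hk0 : ∀ z, 0 ≤ k z) (hk1 : ∫ z, k z = 1) (hb : 0 < b) (n : ℕ)
    [NeZero n] (x : ℕ → ℝ) :
    kernelEst k b n x = cdf (empMeasure n x ∗ kernelLaw k b) := by
  have := isProbabilityMeasure_kernelLaw hk0 hk1 b
  funext t
  have h (i : ℕ) : {z | x i + z ∈ Iic t} = Iic (t - x i) := by
    ext z
    simp [le_sub_iff_add_le']
  rw [cdf_eq_real, measureReal_empMeasure_conv n x measurableSet_Iic]
  simp only [kernelEst, setIntegral_Iic_comp_sub_div k hb, h,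
    measureReal_kernelLaw_Iic hk0 (integrable_of_integral_eq_one hk1) hb, ← Finset.mul_sum]
  field_simp

end KernelLaw

section OrderStatistics

variable {n : ℕ} (x : ℕ → ℝ)

theorem monotone_orderStat : Monotone (orderStat n x) :=
  Tuple.monotone_sort fun j : Fin n => x j

theorem sum_orderStat (f : ℝ → ℝ) :
    ∑ i : Fin n, f (orderStat n x i) = ∑ i ∈ Finset.range n, f (x i) := by
  rw [← Fin.sum_univ_eq_sum_range fun i => f (x i)]
  exact Equiv.sum_comp (Tuple.sort fun j : Fin n => x j) fun i => f (x i)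

theorem cdf_empMeasure [NeZero n] (t : ℝ) :
    cdf (empMeasure n x) t =
      (n : ℝ)⁻¹ * (Finset.univ.filter fun i => orderStat n x i ≤ t).card := by
  rw [cdf_eq_real, ← integral_indicator_one measurableSet_Iic, integral_empMeasure,
    ← sum_orderStat, Finset.card_filter]
  simp [indicator_apply]

theorem leftInv_cdf_empMeasure {u : ℝ} (hu : u ∈ Ioo (0 : ℝ) 1) (i : Fin n)
    (hi : ⌈(n : ℝ) * u⌉₊ = i + 1) :
    leftInv (cdf (empMeasure n x)) u = orderStat n x i := by
  have : NeZero n := i.neZero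
  have hn : (0 : ℝ) < n := Nat.cast_pos.2 (NeZero.pos n)
  refine eq_of_forall_ge_iff fun t => ?_
  rw [leftInv_cdf_le_iff _ hu, cdf_empMeasure, le_inv_mul_iff₀ hn, ← Nat.ceil_le, hi,
    Nat.succ_le_iff, Tuple.lt_card_le_iff_apply_le_of_monotone (monotone_orderStat x)]

theorem setIntegral_natCeil_mul {n : ℕ} (hn : 0 < n) (F : ℕ → ℝ) :
    ∫ u in Ioo (0 : ℝ) 1, F ⌈(n : ℝ) * u⌉₊ = (n : ℝ)⁻¹ * ∑ i ∈ Finset.range n, F (i + 1) := by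
  have hn0 : (0 : ℝ) < n := Nat.cast_pos.2 hn
  have hle (i : ℕ) : (i : ℝ) / n ≤ ((i + 1 : ℕ) : ℝ) / n := by gcongr; exact i.le_succ
  have hval (i : ℕ) : EqOn (fun u : ℝ => F ⌈(n : ℝ) * u⌉₊) (fun _ => F (i + 1))
      (Ioc ((i : ℝ) / n) (((i + 1 : ℕ) : ℝ) / n)) := by
    intro u hu
    have h1 := (div_lt_iff₀' hn0).1 hu.1
    have h2 := (le_div_iff₀' hn0).1 hu.2
    simp only [(Nat.ceil_eq_iff i.succ_ne_zero).2 ⟨h1, h2⟩]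
  have hint (i : ℕ) (_ : i < n) : IntervalIntegrable (fun u : ℝ => F ⌈(n : ℝ) * u⌉₊) volume
      ((i : ℝ) / n) (((i + 1 : ℕ) : ℝ) / n) := by
    rw [intervalIntegrable_iff_integrableOn_Ioc_of_le (hle i)]
    exact (integrableOn_const (by simp) (by simp)).congr_fun (hval i).symm measurableSet_Ioc
  have h := intervalIntegral.sum_integral_adjacent_intervals hint
  simp only [Nat.cast_zero, zero_div, div_self hn0.ne'] at h
  rw [← integral_Ioc_eq_integral_Ioo, ← intervalIntegral.integral_of_le zero_le_one, ← h,
    Finset.mul_sum]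
  refine Finset.sum_congr rfl fun i _ => ?_
  rw [intervalIntegral.integral_of_le (hle i), setIntegral_congr_fun measurableSet_Ioc (hval i),
    setIntegral_const, Real.volume_real_Ioc_of_le (hle i), smul_eq_mul, ← sub_div]
  simp

theorem natCeil_mul_mem_Icc {n : ℕ} (hn : 0 < n) {u : ℝ} (hu : u ∈ Ioo (0 : ℝ) 1) :
    ⌈(n : ℝ) * u⌉₊ ∈ Finset.Icc 1 n := by
  have hn0 : (0 : ℝ) < n := Nat.cast_pos.2 hn
  rw [Finset.mem_Icc, Nat.one_le_ceil_iff, Nat.ceil_le]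
  exact ⟨mul_pos hn0 hu.1, mul_le_of_le_one_right hn0.le hu.2.le⟩

theorem statOrder_eq_setIntegral (g : ℝ → ℝ) (c : ℕ → ℕ → ℝ) (hn : 0 < n) :
    statOrder g c n x =
      ∫ u in Ioo (0 : ℝ) 1, g (leftInv (cdf (empMeasure n x)) u) * score c n u := by
  have : NeZero n := ⟨hn.ne'⟩
  set F : ℕ → ℝ := fun j => g (orderStat n x (Fin.ofNat n (j - 1))) * c n j with hF
  have hcongr : EqOn (fun u => g (leftInv (cdf (empMeasure n x)) u) * score c n u)
      (fun u => F ⌈(n : ℝ) * u⌉₊) (Ioo 0 1) := by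
    intro u hu
    obtain ⟨h1, h2⟩ := Finset.mem_Icc.1 (natCeil_mul_mem_Icc hn hu)
    have hi : ⌈(n : ℝ) * u⌉₊ = (Fin.ofNat n (⌈(n : ℝ) * u⌉₊ - 1)).val + 1 := by
      rw [Fin.val_ofNat, Nat.mod_eq_of_lt (by omega)]
      omega
    simp only [leftInv_cdf_empMeasure x hu _ hi, score, max_eq_right h1, hF]
  rw [setIntegral_congr_fun measurableSet_Ioo hcongr, setIntegral_natCeil_mul hn, statOrder,
    one_div, ← Fin.sum_univ_eq_sum_range]
  simp [hF]

end OrderStatistics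

theorem summable_mul_exp_neg_mul_rpow {c r : ℝ} (hc : 0 < c) (hr : 0 < r) :
    Summable fun n : ℕ => (n : ℝ) * Real.exp (-(c * (n : ℝ) ^ r)) := by
  have h1 : Tendsto (fun n : ℕ => (n : ℝ) ^ r) atTop atTop :=
    (tendsto_rpow_atTop hr).comp tendsto_natCast_atTop_atTop
  have h2 := ((isLittleO_exp_neg_mul_rpow_atTop hc (-(3 / r))).comp_tendsto h1).isBigO
  refine summable_of_isBigO_nat (g := fun n : ℕ => (n : ℝ) ^ (-2 : ℝ))
    (Real.summable_nat_rpow.2 (by norm_num)) ?_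
  refine (((Asymptotics.isBigO_refl (fun n : ℕ => (n : ℝ)) atTop).mul h2).congr_left
    fun n => by simp [neg_mul]).trans_eventuallyEq ?_
  filter_upwards [eventually_ge_atTop 1] with n hn
  have hn' : (0 : ℝ) < n := Nat.cast_pos.2 hn
  have hexp : r * -(3 / r) = -3 := by field_simp
  rw [Function.comp_apply, ← Real.rpow_mul hn'.le, hexp, ← Real.rpow_one_add' hn'.le (by norm_num)]
  norm_num

section Concentration

variable {Ω : Type*} [MeasurableSpace Ω] {P : Measure Ω}

theorem ae_eventually_notMem_of_le_mul_exp_neg_rpow [IsFiniteMeasure P] {A : ℕ → Set Ω}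
    {c r : ℝ} (hc : 0 < c) (hr : 0 < r)
    (hA : ∀ᶠ n : ℕ in atTop, P.real (A n) ≤ (n : ℝ) * Real.exp (-(c * (n : ℝ) ^ r))) :
    ∀ᵐ ω ∂P, ∀ᶠ n in atTop, ω ∉ A n := by
  have hs : Summable fun n => P.real (A n) := by
    refine summable_of_isBigO_nat (summable_mul_exp_neg_mul_rpow hc hr) (.of_norm_eventuallyLE ?_)
    filter_upwards [hA] with n hn
    rwa [Real.norm_of_nonneg measureReal_nonneg]
  exact ae_eventually_notMem (by simpa [ofReal_measureReal] using hs.tsum_ofReal_ne_top)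

variable {ξ : ℕ → Ω → ℝ} {ν : Measure ℝ}

theorem ae_tendsto_integral_empMeasure (hmeas : ∀ i, Measurable (ξ i)) (hind : iIndepFun ξ P)
    (hlaw : ∀ i, P.map (ξ i) = ν) {f : ℝ → ℝ} (hf : Measurable f) (hint : Integrable f ν) :
    ∀ᵐ ω ∂P, Tendsto (fun n => ∫ t, f t ∂empMeasure n (fun i => ξ i ω)) atTop
      (𝓝 (∫ t, f t ∂ν)) := by
  have hint0 : Integrable (fun ω => f (ξ 0 ω)) P :=
    Integrable.comp_measurable (by rwa [hlaw]) (hmeas 0)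
  have hmean : ∫ ω, f (ξ 0 ω) ∂P = ∫ t, f t ∂ν := by
    rw [← hlaw 0, integral_map (hmeas 0).aemeasurable hf.aestronglyMeasurable]
  have hident (i : ℕ) : IdentDistrib (ξ i) (ξ 0) P P :=
    ⟨(hmeas i).aemeasurable, (hmeas 0).aemeasurable, by rw [hlaw, hlaw]⟩
  filter_upwards [strong_law_ae_real (fun i ω => f (ξ i ω)) hint0
    (fun i j hij => (hind.indepFun hij).comp hf hf) fun i => (hident i).comp hf] with ω hω
  simpa only [integral_empMeasure, hmean, div_eq_inv_mul] using hω

theorem ae_tendsto_measureReal_empMeasure (hmeas : ∀ i, Measurable (ξ i)) (hind : iIndepFun ξ P)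
    (hlaw : ∀ i, P.map (ξ i) = ν) [IsFiniteMeasure ν] {s : Set ℝ} (hs : MeasurableSet s) :
    ∀ᵐ ω ∂P, Tendsto (fun n => (empMeasure n fun i => ξ i ω).real s) atTop (𝓝 (ν.real s)) := by
  have h := ae_tendsto_integral_empMeasure hmeas hind hlaw (measurable_one.indicator hs)
    ((integrable_const (1 : ℝ)).indicator hs)
  simpa only [integral_indicator_one hs] using h

section Chernoff

variable {X : ℕ → Ω → ℝ} {t a : ℝ}

theorem integrable_exp_mul_of_le [IsFiniteMeasure P] {Y : Ω → ℝ} (hY : Integrable Y P)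
    (h : ∀ ω, Real.exp (t * Y ω) ≤ 1 + a * Y ω) : Integrable (fun ω => Real.exp (t * Y ω)) P :=
  ((integrable_const 1).add (hY.const_mul a)).mono'
    (Real.continuous_exp.comp_aestronglyMeasurable (hY.1.const_mul t))
    (Eventually.of_forall fun ω => by simpa using h ω)

theorem mgf_le_exp_mul_integral [IsProbabilityMeasure P] {Y : Ω → ℝ} (hY : Integrable Y P)
    (h : ∀ ω, Real.exp (t * Y ω) ≤ 1 + a * Y ω) : mgf Y P t ≤ Real.exp (a * ∫ ω, Y ω ∂P) := by
  calc mgf Y P t ≤ ∫ ω, (1 + a * Y ω) ∂P :=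
        integral_mono (integrable_exp_mul_of_le hY h) ((integrable_const 1).add (hY.const_mul a)) h
    _ = a * ∫ ω, Y ω ∂P + 1 := by
        rw [integral_add (integrable_const 1) (hY.const_mul a), integral_const_mul]
        simp [add_comm]
    _ ≤ Real.exp (a * ∫ ω, Y ω ∂P) := Real.add_one_le_exp _

theorem mgf_sum_range_le_exp (hX : ∀ i, Measurable (X i)) (hint : ∀ i, Integrable (X i) P)
    (hind : iIndepFun X P) (h : ∀ i ω, Real.exp (t * X i ω) ≤ 1 + a * X i ω) {v : ℝ}
    (hv : ∀ i, a * ∫ ω, X i ω ∂P ≤ v) (n : ℕ) :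
    mgf (∑ i ∈ Finset.range n, X i) P t ≤ Real.exp (n * v) := by
  have := hind.isProbabilityMeasure
  calc mgf (∑ i ∈ Finset.range n, X i) P t = ∏ i ∈ Finset.range n, mgf (X i) P t :=
        hind.mgf_sum hX _
    _ ≤ ∏ _i ∈ Finset.range n, Real.exp v := Finset.prod_le_prod (fun _ _ => mgf_nonneg)
        fun i _ => (mgf_le_exp_mul_integral (hint i) (h i)).trans (Real.exp_le_exp.2 (hv i))
    _ = Real.exp (n * v) := by rw [Finset.prod_const, Finset.card_range, ← Real.exp_nat_mul]

theorem measureReal_four_mul_le_sum_le_exp (hX : ∀ i, Measurable (X i)) (hind : iIndepFun X P)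
    {L m : ℝ} (hL : 0 < L) (hb : ∀ i ω, X i ω ∈ Icc 0 L) (hm : ∀ i, ∫ ω, X i ω ∂P ≤ m) (n : ℕ) :
    P.real {ω | n * (4 * m) ≤ ∑ i ∈ Finset.range n, X i ω} ≤ Real.exp (-(2 * m / L * n)) := by
  have := hind.isProbabilityMeasure
  have hint (i : ℕ) : Integrable (X i) P := .of_mem_Icc 0 L (hX i).aemeasurable (.of_forall (hb i))
  have hexp (i : ℕ) (ω : Ω) : Real.exp (L⁻¹ * X i ω) ≤ 1 + 2 * L⁻¹ * X i ω := by
    have h0 : 0 ≤ L⁻¹ * X i ω := mul_nonneg (inv_nonneg.2 hL.le) (hb i ω).1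
    have h1 : L⁻¹ * X i ω ≤ 1 := (inv_mul_le_one₀ hL).2 (hb i ω).2
    have := (abs_le.1 (Real.abs_exp_sub_one_sub_id_le (abs_le.2 ⟨by linarith, h1⟩))).2
    nlinarith
  have hmgf := mgf_sum_range_le_exp hX hint hind hexp
    (fun i => mul_le_mul_of_nonneg_left (hm i) (by positivity)) n
  have hmarkov := measure_ge_le_exp_mul_mgf (n * (4 * m)) (inv_nonneg.2 hL.le)
    (hind.integrable_exp_mul_sum hX fun i (_ : i ∈ Finset.range n) =>
      integrable_exp_mul_of_le (hint i) (hexp i))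
  simp only [Finset.sum_apply] at hmarkov
  refine hmarkov.trans ((mul_le_mul_of_nonneg_left hmgf (Real.exp_pos _).le).trans_eq ?_)
  rw [← Real.exp_add]
  ring_nf

theorem measureReal_sum_le_div_four_le_exp (hX : ∀ i, Measurable (X i)) (hind : iIndepFun X P)
    {m : ℝ} (hb : ∀ i ω, X i ω ∈ Icc 0 1) (hm : ∀ i, m ≤ ∫ ω, X i ω ∂P) (n : ℕ) :
    P.real {ω | ∑ i ∈ Finset.range n, X i ω ≤ n * (m / 4)} ≤ Real.exp (-(n * (m / 4))) := by
  have := hind.isProbabilityMeasure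
  have hint (i : ℕ) : Integrable (X i) P := .of_mem_Icc 0 1 (hX i).aemeasurable (.of_forall (hb i))
  have hexp (i : ℕ) (ω : Ω) : Real.exp (-1 * X i ω) ≤ 1 + -(1 / 2) * X i ω := by
    obtain ⟨h0, h1⟩ := hb i ω
    rw [neg_one_mul, Real.exp_neg, inv_le_iff_one_le_mul₀ (Real.exp_pos _)]
    nlinarith [Real.add_one_le_exp (X i ω)]
  have hmgf := mgf_sum_range_le_exp hX hint hind hexp
    (fun i => mul_le_mul_of_nonpos_left (hm i) (by norm_num)) n
  have hmarkov := measure_le_le_exp_mul_mgf (n * (m / 4)) (by norm_num : (-1 : ℝ) ≤ 0)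
    (hind.integrable_exp_mul_sum hX fun i (_ : i ∈ Finset.range n) =>
      integrable_exp_mul_of_le (hint i) (hexp i))
  simp only [Finset.sum_apply] at hmarkov
  refine hmarkov.trans ((mul_le_mul_of_nonneg_left hmgf (Real.exp_pos _).le).trans_eq ?_)
  rw [← Real.exp_add]
  ring_nf

end Chernoff

theorem measureReal_four_mul_le_integral_empMeasure (hmeas : ∀ i, Measurable (ξ i))
    (hind : iIndepFun ξ P) (hlaw : ∀ i, P.map (ξ i) = ν) {f : ℝ → ℝ} (hf : Measurable f) {L m : ℝ}
    (hL : 0 < L) (hb : ∀ x, f x ∈ Icc 0 L) (hm : ∫ x, f x ∂ν ≤ m) {n : ℕ} (hn : 0 < n) :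
    P.real {ω | 4 * m ≤ ∫ x, f x ∂empMeasure n fun i => ξ i ω} ≤ Real.exp (-(2 * m / L * n)) := by
  have h := measureReal_four_mul_le_sum_le_exp (fun i => hf.comp (hmeas i))
    (hind.comp _ fun _ => hf) hL (fun i ω => hb (ξ i ω)) (m := m) (fun i => ?_) n
  · simpa only [Function.comp_apply, integral_empMeasure,
      le_inv_mul_iff₀ (Nat.cast_pos.2 hn : (0 : ℝ) < n)] using h
  · rwa [← hlaw i, integral_map (hmeas i).aemeasurable hf.aestronglyMeasurable] at hm

theorem measureReal_empMeasure_le_div_four (hmeas : ∀ i, Measurable (ξ i))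
    (hind : iIndepFun ξ P) (hlaw : ∀ i, P.map (ξ i) = ν) {s : Set ℝ} (hs : MeasurableSet s)
    {n : ℕ} (hn : 0 < n) :
    P.real {ω | (empMeasure n fun i => ξ i ω).real s ≤ ν.real s / 4} ≤
      Real.exp (-(n * (ν.real s / 4))) := by
  have hf : Measurable (s.indicator (1 : ℝ → ℝ)) := measurable_one.indicator hs
  have h := measureReal_sum_le_div_four_le_exp (fun i => hf.comp (hmeas i))
    (hind.comp _ fun _ => hf) (fun i ω => ⟨indicator_nonneg (fun _ _ => zero_le_one) _,
      indicator_le_self' (fun _ _ => zero_le_one) _⟩) (m := ν.real s) (fun i => ?_) n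
  · simpa only [Function.comp_apply, ← integral_indicator_one hs, integral_empMeasure,
      inv_mul_le_iff₀ (Nat.cast_pos.2 hn : (0 : ℝ) < n)] using h
  · rw [← integral_indicator_one hs, ← hlaw i,
      integral_map (hmeas i).aemeasurable hf.aestronglyMeasurable]
    rfl

end Concentration

section TypicalPath

/-- The properties of almost every path of an i.i.d. uniform sequence that are needed to control
empirical quantiles: the Glivenko–Cantelli property, and a lower bound, uniform up to the endpoints
of `(0,1)`, for the mass of the two tails of the empirical measure. Thresholds in the first are
rational so that countably many almost sure limits suffice. -/
structure IsTypicalPath (η : ℝ) (x : ℕ → ℝ) : Prop where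
  tendsto_Iio (q : ℚ) : (q : ℝ) ∈ Ioo (0 : ℝ) 1 →
    Tendsto (fun n => (empMeasure n x).real (Iio q)) atTop (𝓝 q)
  tendsto_Ioi (q : ℚ) : (q : ℝ) ∈ Ioo (0 : ℝ) 1 →
    Tendsto (fun n => (empMeasure n x).real (Ioi q)) atTop (𝓝 (1 - q))
  exists_rpow_le : ∃ C, 0 ≤ C ∧ ∀ᶠ n : ℕ in atTop, ∀ t ∈ Ioo (0 : ℝ) 1,
    t ^ (1 + η) ≤ C * ((empMeasure n x).real (Iio t) + (n : ℝ)⁻¹) ∧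
    (1 - t) ^ (1 + η) ≤ C * ((empMeasure n x).real (Ioi t) + (n : ℝ)⁻¹)

theorem rpow_le_of_grid {F : ℝ → ℝ} (hF : Monotone F) (hF0 : ∀ t, 0 ≤ F t) {n : ℕ} (hn : 0 < n)
    {η : ℝ} (hη : 0 ≤ η)
    (h : ∀ j ∈ Finset.Icc 1 n, (n : ℝ)⁻¹ ≤ ((j : ℝ) / n) ^ (1 + η) → (j : ℝ) / n / 4 ≤ F (j / n))
    {t : ℝ} (ht : t ∈ Ioo (0 : ℝ) 1) :
    t ^ (1 + η) ≤ (8 + 2 ^ (1 + η)) * (F t + (n : ℝ)⁻¹) := by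
  obtain ⟨ht0, ht1⟩ := ht
  have hn0 : (0 : ℝ) < n := Nat.cast_pos.2 hn
  have h2 : (0 : ℝ) < 2 ^ (1 + η) := by positivity
  rcases lt_or_ge ((t / 2) ^ (1 + η)) (n : ℝ)⁻¹ with hlt | hge
  · rw [Real.div_rpow ht0.le zero_le_two, div_lt_iff₀' h2] at hlt
    nlinarith [mul_nonneg h2.le (hF0 t), hF0 t, inv_pos.2 hn0]
  · have hself {r : ℝ} (hr0 : 0 < r) (hr1 : r ≤ 1) : r ^ (1 + η) ≤ r :=
      Real.rpow_le_self_of_le_one hr0.le hr1 (by linarith)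
    have hnt : 2 ≤ n * t := by
      have := hge.trans (hself (by linarith) (by linarith))
      rw [inv_le_iff_one_le_mul₀' hn0] at this
      linarith
    set j := ⌊(n : ℝ) * t⌋₊
    have hjt : (j : ℝ) / n ≤ t := (div_le_iff₀' hn0).2 (Nat.floor_le (by linarith))
    have htj : t / 2 ≤ (j : ℝ) / n := by
      rw [le_div_iff₀' hn0]
      linarith [Nat.lt_floor_add_one ((n : ℝ) * t)]
    have hjn : j ∈ Finset.Icc 1 n := by
      refine Finset.mem_Icc.2 ⟨Nat.le_floor (by push_cast; linarith), ?_⟩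
      exact Nat.floor_le_of_le (mul_le_of_le_one_right hn0.le ht1.le)
    have hFj := h j hjn (hge.trans (Real.rpow_le_rpow (by linarith) htj (by linarith)))
    nlinarith [hself ht0 ht1.le, hF hjt, mul_nonneg h2.le (hF0 t), mul_pos h2 (inv_pos.2 hn0),
      inv_pos.2 hn0]

theorem rpow_le_natCast_mul_of_inv_le {n : ℕ} (hn : 0 < n) {η t : ℝ} (hη : 0 < η) (ht : 0 ≤ t)
    (h : (n : ℝ)⁻¹ ≤ t ^ (1 + η)) : (n : ℝ) ^ (1 - (1 + η)⁻¹) ≤ n * t := by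
  have hn0 : (0 : ℝ) < n := Nat.cast_pos.2 hn
  rw [sub_eq_add_neg, Real.rpow_one_add' hn0.le, Real.rpow_neg hn0.le, ← Real.inv_rpow hn0.le]
  · gcongr
    exact (Real.rpow_inv_le_iff_of_pos (inv_nonneg.2 hn0.le) ht (by linarith)).2 h
  · exact (sub_pos.2 (inv_lt_one_of_one_lt₀ (lt_add_of_pos_right 1 hη))).ne'

variable {Ω : Type*} [MeasurableSpace Ω] {P : Measure Ω} {ξ : ℕ → Ω → ℝ} {ν : Measure ℝ}

theorem ae_eventually_rpow_le_measureReal_empMeasure (hmeas : ∀ i, Measurable (ξ i))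
    (hind : iIndepFun ξ P) (hlaw : ∀ i, P.map (ξ i) = ν) {s : ℝ → Set ℝ} (hs : Monotone s)
    (hs_meas : ∀ t, MeasurableSet (s t)) (hν : ∀ t ∈ Icc (0 : ℝ) 1, ν.real (s t) = t)
    {η : ℝ} (hη : 0 < η) :
    ∀ᵐ ω ∂P, ∀ᶠ n : ℕ in atTop, ∀ t ∈ Ioo (0 : ℝ) 1, t ^ (1 + η) ≤
      (8 + 2 ^ (1 + η)) * ((empMeasure n fun i => ξ i ω).real (s t) + (n : ℝ)⁻¹) := by
  have := hind.isProbabilityMeasure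
  set grid : ℕ → Finset ℕ := fun n =>
    {j ∈ Finset.Icc 1 n | (n : ℝ)⁻¹ ≤ ((j : ℝ) / n) ^ (1 + η)}
  set deficient : ℕ → ℕ → Set Ω := fun n j =>
    {ω | (empMeasure n fun i => ξ i ω).real (s (j / n)) ≤ (j : ℝ) / n / 4}
  have hprob {n : ℕ} (hn : 0 < n) {j : ℕ} (hj : j ∈ grid n) :
      P.real (deficient n j) ≤ Real.exp (-(1 / 4 * (n : ℝ) ^ (1 - (1 + η)⁻¹))) := by
    obtain ⟨hjn, hj⟩ := Finset.mem_filter.1 hj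
    have hjn' : (j : ℝ) ≤ n := Nat.cast_le.2 (Finset.mem_Icc.1 hjn).2
    have h := measureReal_empMeasure_le_div_four hmeas hind hlaw (hs_meas (j / n)) hn
    rw [hν _ ⟨by positivity, div_le_one_of_le₀ hjn' (by positivity)⟩] at h
    refine h.trans (Real.exp_le_exp.2 ?_)
    have := rpow_le_natCast_mul_of_inv_le hn hη (by positivity) hj
    linarith
  have hfew := ae_eventually_notMem_of_le_mul_exp_neg_rpow (P := P) (c := 1 / 4)
    (r := 1 - (1 + η)⁻¹) (A := fun n => ⋃ j ∈ grid n, deficient n j) (by norm_num)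
    (sub_pos.2 (inv_lt_one_of_one_lt₀ (by linarith))) ?_
  · filter_upwards [hfew] with ω hω
    filter_upwards [hω, eventually_gt_atTop 0] with n hn hn0 t ht
    refine rpow_le_of_grid (fun a b hab => measureReal_mono (hs hab))
      (fun _ => measureReal_nonneg) hn0 hη.le (fun j hj hj' => ?_) ht
    contrapose! hn
    exact mem_biUnion (Finset.mem_coe.2 (Finset.mem_filter.2 ⟨hj, hj'⟩)) hn.le
  · filter_upwards [eventually_gt_atTop 0] with n hn
    refine (measureReal_biUnion_finset_le _ _).trans ((Finset.sum_le_card_nsmul _ _ _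
      fun j hj => hprob hn hj).trans ?_)
    rw [nsmul_eq_mul]
    gcongr
    simpa using Finset.card_filter_le (Finset.Icc 1 n) _

theorem ae_isTypicalPath (hmeas : ∀ i, Measurable (ξ i)) (hind : iIndepFun ξ P)
    (hlaw : ∀ i, P.map (ξ i) = volume.restrict (Ioo 0 1)) {η : ℝ} (hη : 0 < η) :
    ∀ᵐ ω ∂P, IsTypicalPath η fun i => ξ i ω := by
  have hIio (t : ℝ) (ht : t ∈ Icc (0 : ℝ) 1) :
      (volume.restrict (Ioo (0 : ℝ) 1)).real (Iio t) = t := by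
    rw [measureReal_restrict_apply measurableSet_Iio, inter_comm, Ioo_inter_Iio,
      min_eq_right ht.2, Real.volume_real_Ioo_of_le ht.1, sub_zero]
  have hIoi (t : ℝ) (ht : t ∈ Icc (0 : ℝ) 1) :
      (volume.restrict (Ioo (0 : ℝ) 1)).real (Ioi (1 - t)) = t := by
    rw [measureReal_restrict_apply measurableSet_Ioi, inter_comm, Ioo_inter_Ioi,
      max_eq_right (by linarith [ht.2]), Real.volume_real_Ioo_of_le (by linarith [ht.1])]
    ring
  have hGC (s : ℚ → Set ℝ) (hs : ∀ q, MeasurableSet (s q)) := ae_all_iff.2 fun q =>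
    ae_tendsto_measureReal_empMeasure hmeas hind hlaw (hs q)
  filter_upwards [hGC (fun q => Iio (q : ℝ)) fun _ => measurableSet_Iio,
    hGC (fun q => Ioi (q : ℝ)) fun _ => measurableSet_Ioi,
    ae_eventually_rpow_le_measureReal_empMeasure hmeas hind hlaw (s := Iio)
      (fun _ _ => Iio_subset_Iio) (fun _ => measurableSet_Iio) hIio hη,
    ae_eventually_rpow_le_measureReal_empMeasure hmeas hind hlaw (s := fun t => Ioi (1 - t))
      (fun _ _ h => Ioi_subset_Ioi (by linarith)) (fun _ => measurableSet_Ioi) hIoi hη]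
    with ω hlt hgt hleft hright
  refine ⟨fun q hq => ?_, fun q hq => ?_, 8 + 2 ^ (1 + η), by positivity, ?_⟩
  · simpa only [hIio q ⟨hq.1.le, hq.2.le⟩] using hlt q
  · have h := hIoi (1 - q) ⟨by linarith [hq.2], by linarith [hq.1]⟩
    rw [sub_sub_cancel] at h
    simpa only [h] using hgt q
  · filter_upwards [hleft, hright] with n hl hr t ht
    refine ⟨hl t ht, ?_⟩
    simpa using hr (1 - t) ⟨by linarith [ht.2], by linarith [ht.1]⟩

end TypicalPath

section VanishingNoise

/-- Probability laws `κ n` that concentrate at `0` while keeping a mass bounded below on each closed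
half-line ending at `0`. Convolving with `κ n` models smoothing with a vanishing bandwidth, the case
`κ n = δ₀` being no smoothing at all. -/
structure IsVanishingNoise (κ : ℕ → Measure ℝ) : Prop where
  tendsto_Iic (r : ℝ) : 0 < r → Tendsto (fun n => (κ n).real (Iic r)) atTop (𝓝 1)
  tendsto_Ici (r : ℝ) : r < 0 → Tendsto (fun n => (κ n).real (Ici r)) atTop (𝓝 1)
  exists_le : ∃ p, 0 < p ∧ ∀ᶠ n in atTop, p ≤ (κ n).real (Iic 0) ∧ p ≤ (κ n).real (Ici 0)

theorem isVanishingNoise_dirac_zero : IsVanishingNoise fun _ => Measure.dirac 0 where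
  tendsto_Iic r hr := by simp [measureReal_def, hr.le]
  tendsto_Ici r hr := by simp [measureReal_def, hr.le]
  exists_le := ⟨1, one_pos, by simp [measureReal_def]⟩

theorem isVanishingNoise_map_mul {μ : Measure ℝ} [IsProbabilityMeasure μ]
    (hneg : 0 < μ.real (Iic 0)) (hpos : 0 < μ.real (Ici 0)) {b : ℕ → ℝ}
    (hb : ∀ᶠ n in atTop, 0 < b n) (hb0 : Tendsto b atTop (𝓝 0)) :
    IsVanishingNoise fun n => μ.map (b n * ·) := by
  have hIic (r : ℝ) : (fun n => μ.real (Iic (r / b n))) =ᶠ[atTop]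
      fun n => (μ.map (b n * ·)).real (Iic r) := by
    filter_upwards [hb] with n hn
    rw [map_measureReal_apply (measurable_const_mul _) measurableSet_Iic]
    congr 1 with z
    simp [le_div_iff₀' hn]
  have hIci (r : ℝ) : (fun n => μ.real (Ici (r / b n))) =ᶠ[atTop]
      fun n => (μ.map (b n * ·)).real (Ici r) := by
    filter_upwards [hb] with n hn
    rw [map_measureReal_apply (measurable_const_mul _) measurableSet_Ici]
    congr 1 with z
    simp [div_le_iff₀' hn]
  have hinv : Tendsto (fun n => (b n)⁻¹) atTop atTop :=
    (tendsto_nhdsWithin_iff.2 ⟨hb0, hb⟩).inv_tendsto_nhdsGT_zero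
  have htoReal {s : ℝ → Set ℝ} {l : Filter ℝ} (h : Tendsto (fun r => μ (s r)) l (𝓝 (μ univ))) :
      Tendsto (fun r => μ.real (s r)) l (𝓝 1) := by
    simpa [Function.comp_def, measureReal_def] using
      (ENNReal.tendsto_toReal (measure_ne_top μ univ)).comp h
  refine ⟨fun r hr => ?_, fun r hr => ?_, min (μ.real (Iic 0)) (μ.real (Ici 0)),
    lt_min hneg hpos, ?_⟩
  · exact ((htoReal (tendsto_measure_Iic_atTop μ)).comp
      (hinv.const_mul_atTop hr)).congr' (hIic r)
  · exact ((htoReal (tendsto_measure_Ici_atBot μ)).comp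
      (hinv.const_mul_atTop_of_neg hr)).congr' (hIci r)
  · filter_upwards [hIic 0, hIci 0] with n h1 h2
    rw [← h1, ← h2, zero_div]
    exact ⟨min_le_left _ _, min_le_right _ _⟩

variable {η : ℝ} {x : ℕ → ℝ} {κ : ℕ → Measure ℝ} [∀ n, IsProbabilityMeasure (κ n)]

theorem IsTypicalPath.eventually_lt_leftInv (hx : IsTypicalPath η x) (hκ : IsVanishingNoise κ)
    {a u : ℝ} (hu : u ∈ Ioo (0 : ℝ) 1) (hau : a < u) :
    ∀ᶠ n in atTop, a < leftInv (cdf (empMeasure n x ∗ κ n)) u := by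
  obtain ⟨q, hq, hqu⟩ := exists_rat_btwn (max_lt hau hu.1)
  have hlim := (hx.tendsto_Ioi q ⟨(le_max_right _ _).trans_lt hq, hqu.trans hu.2⟩).mul
    (hκ.tendsto_Ici (a - q) (sub_neg.2 ((le_max_left _ _).trans_lt hq)))
  rw [mul_one] at hlim
  filter_upwards [hlim.eventually_const_lt (sub_lt_sub_left hqu 1), eventually_ne_atTop 0]
    with n hn hn0
  have : NeZero n := ⟨hn0⟩
  by_contra! hle
  refine hn.not_ge ?_
  calc (empMeasure n x).real (Ioi q) * (κ n).real (Ici (a - q))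
      ≤ (empMeasure n x ∗ κ n).real (Ioi (leftInv (cdf (empMeasure n x ∗ κ n)) u)) :=
        measureReal_mul_le_conv fun y (hy : q < y) z (hz : a - q ≤ z) => mem_Ioi.2 (by linarith)
    _ ≤ 1 - u := measureReal_Ioi_leftInv_cdf_le _ hu

theorem IsTypicalPath.eventually_leftInv_lt (hx : IsTypicalPath η x) (hκ : IsVanishingNoise κ)
    {a u : ℝ} (hu : u ∈ Ioo (0 : ℝ) 1) (hua : u < a) :
    ∀ᶠ n in atTop, leftInv (cdf (empMeasure n x ∗ κ n)) u < a := by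
  obtain ⟨q, hqu, hq⟩ := exists_rat_btwn (lt_min hua hu.2)
  have hlim := (hx.tendsto_Iio q ⟨hu.1.trans hqu, hq.trans_le (min_le_right _ _)⟩).mul
    (hκ.tendsto_Iic (a - q) (sub_pos.2 (hq.trans_le (min_le_left _ _))))
  rw [mul_one] at hlim
  filter_upwards [hlim.eventually_const_lt hqu, eventually_ne_atTop 0] with n hn hn0
  have : NeZero n := ⟨hn0⟩
  by_contra! hle
  refine hn.not_ge ?_
  calc (empMeasure n x).real (Iio q) * (κ n).real (Iic (a - q))
      ≤ (empMeasure n x ∗ κ n).real (Iio (leftInv (cdf (empMeasure n x ∗ κ n)) u)) :=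
        measureReal_mul_le_conv fun y (hy : y < q) z (hz : z ≤ a - q) => mem_Iio.2 (by linarith)
    _ ≤ u := measureReal_Iio_leftInv_cdf_le _ hu

theorem IsTypicalPath.tendsto_leftInv (hx : IsTypicalPath η x) (hκ : IsVanishingNoise κ)
    {u : ℝ} (hu : u ∈ Ioo (0 : ℝ) 1) :
    Tendsto (fun n => leftInv (cdf (empMeasure n x ∗ κ n)) u) atTop (𝓝 u) :=
  tendsto_order.2 ⟨fun _ => hx.eventually_lt_leftInv hκ hu, fun _ => hx.eventually_leftInv_lt hκ hu⟩

theorem IsTypicalPath.exists_rpow_leftInv_le (hx : IsTypicalPath η x) (hκ : IsVanishingNoise κ) :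
    ∃ C, 0 ≤ C ∧ ∀ᶠ n : ℕ in atTop, ∀ u ∈ Ioo (0 : ℝ) 1,
      leftInv (cdf (empMeasure n x ∗ κ n)) u ∈ Ioo (0 : ℝ) 1 →
      leftInv (cdf (empMeasure n x ∗ κ n)) u ^ (1 + η) ≤ C * (u + (n : ℝ)⁻¹) ∧
      (1 - leftInv (cdf (empMeasure n x ∗ κ n)) u) ^ (1 + η) ≤ C * (1 - u + (n : ℝ)⁻¹) := by
  obtain ⟨C, hC, hx⟩ := hx.exists_rpow_le
  obtain ⟨p, hp, hκ⟩ := hκ.exists_le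
  have hweaken {r s t m : ℝ} (h : r ≤ C * (t + m)) (hm : 0 ≤ m) (hs : 0 ≤ s)
      (hts : t * p ≤ s) : r ≤ C * (p⁻¹ + 1) * (s + m) := by
    have hts' : t ≤ p⁻¹ * s := (le_inv_mul_iff₀' hp).2 hts
    rw [mul_assoc]
    refine h.trans (mul_le_mul_of_nonneg_left ?_ hC)
    linarith [mul_nonneg (inv_pos.2 hp).le hm]
  refine ⟨C * (p⁻¹ + 1), by positivity, ?_⟩
  filter_upwards [hx, hκ, eventually_ne_atTop 0] with n hx ⟨hIic, hIci⟩ hn0 u hu hG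
  have : NeZero n := ⟨hn0⟩
  refine ⟨hweaken (hx _ hG).1 (by positivity) hu.1.le ?_,
    hweaken (hx _ hG).2 (by positivity) (sub_nonneg.2 hu.2.le) ?_⟩
  · exact (mul_le_mul_of_nonneg_left hIic measureReal_nonneg).trans
      ((measureReal_mul_le_conv fun y hy z (hz : z ≤ 0) =>
        mem_Iio.2 (add_lt_of_lt_of_nonpos hy hz)).trans
        (measureReal_Iio_leftInv_cdf_le _ hu))
  · exact (mul_le_mul_of_nonneg_left hIci measureReal_nonneg).trans
      ((measureReal_mul_le_conv fun y hy z (hz : 0 ≤ z) =>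
        mem_Ioi.2 (lt_add_of_lt_of_nonneg hy hz)).trans
        (measureReal_Ioi_leftInv_cdf_le _ hu))

end VanishingNoise

section SmoothedMeans

theorem le_add_rpow_mul_rpow {q : ℝ} (hq : 1 ≤ q) {R : ℝ} (hR : 0 < R) (w : ℝ≥0∞) :
    w ≤ ENNReal.ofReal R + ENNReal.ofReal (R ^ (1 - q)) * w ^ q := by
  have hR0 : ENNReal.ofReal R ≠ 0 := by simpa using hR
  rcases le_total w (ENNReal.ofReal R) with h | h
  · exact h.trans le_self_add
  · calc w = ENNReal.ofReal R ^ (1 - q) * (ENNReal.ofReal R ^ (q - 1) * w) := by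
          rw [← mul_assoc, ← ENNReal.rpow_add _ _ hR0 ENNReal.ofReal_ne_top]
          simp
      _ ≤ ENNReal.ofReal R ^ (1 - q) * (w ^ (q - 1) * w) := by
          gcongr
      _ = ENNReal.ofReal (R ^ (1 - q)) * w ^ q := by
          rw [ENNReal.ofReal_rpow_of_pos hR, ← sub_add_cancel q 1,
            ENNReal.rpow_add_of_nonneg _ _ (sub_nonneg.2 hq) zero_le_one, ENNReal.rpow_one,
            sub_add_cancel]
      _ ≤ ENNReal.ofReal R + ENNReal.ofReal (R ^ (1 - q)) * w ^ q := le_add_self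

variable {κ : Measure ℝ} [IsProbabilityMeasure κ] {W : ℝ → ℝ≥0∞}

theorem lintegral_add_left_le_rpow {q : ℝ} (hq : 1 ≤ q) (hW : Measurable W) {A C : ℝ} (hC : 0 ≤ C)
    (hA : 0 ≤ A) (hWq : ∫⁻ t, W t ^ q ≤ ENNReal.ofReal A) {n : ℕ} (hn : 0 < n)
    (hκ : κ ≤ ENNReal.ofReal (C * n) • volume) (x : ℝ) :
    ∫⁻ z, W (x + z) ∂κ ≤ ENNReal.ofReal ((1 + C * A) * (n : ℝ) ^ q⁻¹) := by
  have hn0 : (0 : ℝ) < n := Nat.cast_pos.2 hn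
  set R : ℝ := (n : ℝ) ^ q⁻¹ with hRdef
  have hR : 0 < R := Real.rpow_pos_of_pos hn0 _
  have hbalance : R ^ (1 - q) * n = R := by
    rw [Real.rpow_sub hR, Real.rpow_one, hRdef, ← Real.rpow_mul hn0.le,
      inv_mul_cancel₀ (by linarith), Real.rpow_one, div_mul_cancel₀ _ hn0.ne']
  have hpow : ∫⁻ z, W (x + z) ^ q ∂κ ≤ ENNReal.ofReal (C * n * A) := by
    calc ∫⁻ z, W (x + z) ^ q ∂κ
        ≤ ∫⁻ z, W (x + z) ^ q ∂(ENNReal.ofReal (C * n) • volume) := lintegral_mono' hκ le_rfl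
      _ = ENNReal.ofReal (C * n) * ∫⁻ z, W z ^ q := by
          rw [lintegral_smul_measure, lintegral_add_left_eq_self (fun z => W z ^ q), smul_eq_mul]
      _ ≤ ENNReal.ofReal (C * n * A) := by
          rw [ENNReal.ofReal_mul (p := C * n) (by positivity)]
          gcongr
  calc ∫⁻ z, W (x + z) ∂κ
      ≤ ∫⁻ z, (ENNReal.ofReal R + ENNReal.ofReal (R ^ (1 - q)) * W (x + z) ^ q) ∂κ :=
        lintegral_mono fun z => le_add_rpow_mul_rpow hq hR _
    _ = ENNReal.ofReal R + ENNReal.ofReal (R ^ (1 - q)) * ∫⁻ z, W (x + z) ^ q ∂κ := by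
        rw [lintegral_add_left measurable_const, lintegral_const_mul _ (by fun_prop)]
        simp
    _ ≤ ENNReal.ofReal R + ENNReal.ofReal (R ^ (1 - q)) * ENNReal.ofReal (C * n * A) := by gcongr
    _ = ENNReal.ofReal ((1 + C * A) * R) := by
        rw [← ENNReal.ofReal_mul (by positivity), ← ENNReal.ofReal_add hR.le (by positivity)]
        congr 1
        linear_combination (C * A) * hbalance

theorem lintegral_lintegral_add_le {ν : Measure ℝ} [SFinite ν] (hν : ν ≤ volume)
    (hW : Measurable W) : ∫⁻ x, ∫⁻ z, W (x + z) ∂κ ∂ν ≤ ∫⁻ t, W t := by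
  rw [← Measure.lintegral_conv hW, Measure.conv_comm]
  have h := conv_le_smul_volume (μ := κ) (hν.trans_eq (one_smul _ _).symm)
  exact lintegral_mono' (h.trans_eq (one_smul _ _)) le_rfl

end SmoothedMeans

section Domination

variable {Ω : Type*} [MeasurableSpace Ω] {P : Measure Ω} {ξ : ℕ → Ω → ℝ} {ν : Measure ℝ}
  {κ : ℕ → Measure ℝ} {W : ℝ → ℝ≥0∞} {m : ℝ}

theorem measureReal_lt_lintegral_empMeasure_conv_le (hmeas : ∀ i, Measurable (ξ i))
    (hind : iIndepFun ξ P) (hlaw : ∀ i, P.map (ξ i) = ν) (hν : ν ≤ volume) {κ : Measure ℝ}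
    [IsProbabilityMeasure κ] (hW : Measurable W) {L : ℝ} (hL : 0 < L)
    (hWL : ∀ x, ∫⁻ z, W (x + z) ∂κ ≤ ENNReal.ofReal L) (hm : 0 ≤ m)
    (hWm : ∫⁻ t, W t ≤ ENNReal.ofReal m) {n : ℕ} (hn : 0 < n) :
    P.real {ω | ENNReal.ofReal (4 * m) < ∫⁻ t, W t ∂(empMeasure n (fun i => ξ i ω) ∗ κ)} ≤
      Real.exp (-(2 * m / L * n)) := by
  have := hind.isProbabilityMeasure
  have : IsProbabilityMeasure ν := hlaw 0 ▸ Measure.isProbabilityMeasure_map (hmeas 0).aemeasurable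
  set S : ℝ → ℝ≥0∞ := fun x => ∫⁻ z, W (x + z) ∂κ
  have hSmeas : Measurable S := by
    unfold S
    fun_prop
  have hStop (x : ℝ) : S x ≠ ∞ := ne_top_of_le_ne_top ENNReal.ofReal_ne_top (hWL x)
  have hmean : ∫ x, (S x).toReal ∂ν ≤ m := by
    rw [integral_toReal hSmeas.aemeasurable (Eventually.of_forall fun x => (hStop x).lt_top)]
    exact ENNReal.toReal_le_of_le_ofReal hm ((lintegral_lintegral_add_le hν hW).trans hWm)
  refine (measureReal_mono fun ω hω => ?_).trans
    (measureReal_four_mul_le_integral_empMeasure hmeas hind hlaw hSmeas.ennreal_toReal hL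
      (fun x => ⟨ENNReal.toReal_nonneg, ENNReal.toReal_le_of_le_ofReal hL.le (hWL x)⟩) hmean hn)
  have hfin : ∫⁻ x, S x ∂(empMeasure n fun i => ξ i ω) ≠ ∞ :=
    ((lintegral_mono hWL).trans_lt (by simp [ENNReal.mul_lt_top, measure_lt_top])).ne
  rw [mem_ofPred_eq, Measure.lintegral_conv hW] at hω
  rw [mem_ofPred_eq, integral_toReal hSmeas.aemeasurable
    (Eventually.of_forall fun x => (hStop x).lt_top)]
  exact (ENNReal.ofReal_le_iff_le_toReal hfin).1 hω.le

theorem ae_eventually_lintegral_empMeasure_conv_le (hmeas : ∀ i, Measurable (ξ i))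
    (hind : iIndepFun ξ P) (hlaw : ∀ i, P.map (ξ i) = ν) (hν : ν ≤ volume)
    [∀ n, IsProbabilityMeasure (κ n)] {C : ℝ} (hC : 0 ≤ C)
    (hκ : ∀ᶠ n : ℕ in atTop, κ n ≤ ENNReal.ofReal (C * n) • volume) {q : ℝ} (hq : 1 < q)
    (hW : Measurable W) (hWq : ∫⁻ t, W t ^ q ≠ ∞) (hm : 0 < m)
    (hWm : ∫⁻ t, W t ≤ ENNReal.ofReal m) :
    ∀ᵐ ω ∂P, ∀ᶠ n in atTop,
      ∫⁻ t, W t ∂(empMeasure n (fun i => ξ i ω) ∗ κ n) ≤ ENNReal.ofReal (4 * m) := by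
  have := hind.isProbabilityMeasure
  set A := (∫⁻ t, W t ^ q).toReal
  have hCA : 0 < 1 + C * A := by positivity
  have hfew := ae_eventually_notMem_of_le_mul_exp_neg_rpow (P := P) (c := 2 * m / (1 + C * A))
    (r := 1 - q⁻¹) (by positivity) (sub_pos.2 (inv_lt_one_of_one_lt₀ hq)) (A := fun n =>
      {ω | ENNReal.ofReal (4 * m) < ∫⁻ t, W t ∂(empMeasure n (fun i => ξ i ω) ∗ κ n)}) ?_
  · simpa only [mem_ofPred_eq, not_lt] using hfew
  · filter_upwards [hκ, eventually_gt_atTop 0] with n hκn hn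
    have hn0 : (0 : ℝ) < n := Nat.cast_pos.2 hn
    have hbound := lintegral_add_left_le_rpow hq.le hW hC ENNReal.toReal_nonneg
      (ENNReal.ofReal_toReal hWq).ge hn hκn
    refine (measureReal_lt_lintegral_empMeasure_conv_le hmeas hind hlaw hν hW (by positivity)
      hbound hm.le hWm hn).trans ?_
    have hexponent : 2 * m / ((1 + C * A) * (n : ℝ) ^ q⁻¹) * n =
        2 * m / (1 + C * A) * (n : ℝ) ^ (1 - q⁻¹) := by
      rw [Real.rpow_sub hn0, Real.rpow_one]
      field_simp
    rw [hexponent]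
    exact le_mul_of_one_le_left (Real.exp_pos _).le (Nat.one_le_cast.2 hn)

theorem ae_eventually_lintegral_empMeasure_le (hmeas : ∀ i, Measurable (ξ i))
    (hind : iIndepFun ξ P) (hlaw : ∀ i, P.map (ξ i) = ν) {f : ℝ → ℝ} (hf : Measurable f)
    (hm : 0 < m) (hfm : ∫⁻ t, ‖f t‖ₑ ∂ν ≤ ENNReal.ofReal m) :
    ∀ᵐ ω ∂P, ∀ᶠ n in atTop,
      ∫⁻ t, ‖f t‖ₑ ∂(empMeasure n fun i => ξ i ω) ≤ ENNReal.ofReal (4 * m) := by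
  have hint : Integrable f ν :=
    ⟨hf.aestronglyMeasurable, hfm.trans_lt ENNReal.ofReal_lt_top⟩
  have hmean : ∫ t, ‖f t‖ ∂ν < 4 * m := by
    rw [integral_norm_eq_lintegral_enorm hint.1]
    linarith [ENNReal.toReal_le_of_le_ofReal hm.le hfm]
  filter_upwards [ae_tendsto_integral_empMeasure hmeas hind hlaw hf.norm hint.norm] with ω hω
  filter_upwards [hω.eventually_lt_const hmean] with n hn
  rw [← ofReal_integral_norm_eq_lintegral_enorm (integrable_empMeasure n _ f)]
  exact ENNReal.ofReal_le_ofReal hn.le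

end Domination

section Weight

/-- The weight `[t (1-t)]^{-s}` on `(0,1)`, extended by `0`. It dominates `g J_n`, both at `t`
itself and along empirical quantiles. -/
def weight (s : ℝ) : ℝ → ℝ := (Ioo 0 1).indicator fun t => t ^ (-s) * (1 - t) ^ (-s)

variable {s t : ℝ}

theorem weight_of_mem (ht : t ∈ Ioo (0 : ℝ) 1) : weight s t = t ^ (-s) * (1 - t) ^ (-s) :=
  indicator_of_mem ht _

theorem weight_nonneg : 0 ≤ weight s t :=
  indicator_nonneg (fun _ ht => mul_nonneg (Real.rpow_nonneg ht.1.le _)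
    (Real.rpow_nonneg (sub_nonneg.2 ht.2.le) _)) t

theorem measurable_weight : Measurable (weight s) :=
  Measurable.indicator (by fun_prop) measurableSet_Ioo

theorem weight_rpow {q : ℝ} (hq : q ≠ 0) : weight s t ^ q = weight (s * q) t := by
  by_cases ht : t ∈ Ioo (0 : ℝ) 1
  · have h0 := ht.1.le
    have h1 := (sub_pos.2 ht.2).le
    rw [weight_of_mem ht, weight_of_mem ht,
      Real.mul_rpow (Real.rpow_nonneg h0 _) (Real.rpow_nonneg h1 _), ← Real.rpow_mul h0,
      ← Real.rpow_mul h1, neg_mul]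
  · simp [weight, indicator_of_notMem ht, Real.zero_rpow hq]

theorem integrable_weight (hs : s < 1) : Integrable (weight s) := by
  have hs' : 0 < 1 - s := sub_pos.2 hs
  have hβ := beta_pos hs' hs'
  have hint : Integrable (betaPDFReal (1 - s) (1 - s)) := by
    refine ⟨(measurable_betaPDFReal _ _).aestronglyMeasurable, ?_⟩
    rw [hasFiniteIntegral_iff_ofReal (Eventually.of_forall fun t => ?_)]
    · exact (lintegral_betaPDF_eq_one hs' hs').trans_lt ENNReal.one_lt_top
    · unfold betaPDFReal
      split_ifs with ht
      · have := sub_pos.2 ht.2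
        have := ht.1
        positivity
      · rfl
  convert hint.const_mul (beta (1 - s) (1 - s)) using 1
  funext t
  by_cases ht : t ∈ Ioo (0 : ℝ) 1
  · rw [weight_of_mem ht, betaPDFReal, if_pos (show 0 < t ∧ t < 1 from ht), sub_sub_cancel_left]
    field_simp
  · rw [weight, indicator_of_notMem ht, betaPDFReal,
      if_neg (show ¬(0 < t ∧ t < 1) from ht), mul_zero]

theorem memLp_weight {q : ℝ} (hq : 0 < q) (hs : s * q < 1) :
    MemLp (weight s) (ENNReal.ofReal q) := by
  rw [← integrable_norm_rpow_iff measurable_weight.aestronglyMeasurable (by simpa using hq)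
    ENNReal.ofReal_ne_top, ENNReal.toReal_ofReal hq.le]
  simpa only [Real.norm_of_nonneg weight_nonneg, weight_rpow hq.ne'] using integrable_weight hs

end Weight

section Score

variable (c : ℕ → ℕ → ℝ) (n : ℕ)

theorem measurable_score : Measurable (score c n) :=
  (measurable_from_nat (f := fun j => c n (max 1 j))).comp
    (Nat.measurable_ceil.comp (measurable_const_mul (n : ℝ)))

theorem exists_abs_score_le : ∃ C, ∀ u ∈ Ioo (0 : ℝ) 1, |score c n u| ≤ C := by
  refine ⟨∑ j ∈ Finset.range (n + 2), |c n j|, fun u hu => ?_⟩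
  refine Finset.single_le_sum (f := fun j => |c n j|) (fun j _ => abs_nonneg _) ?_
  have : ⌈(n : ℝ) * u⌉₊ ≤ n := Nat.ceil_le.2 (mul_le_of_le_one_right n.cast_nonneg hu.2.le)
  exact Finset.mem_range.2 (by omega)

variable {n}

theorem exists_score_eq_of_pos (hn : 0 < n) {u : ℝ} (hu : u ∈ Ioo (0 : ℝ) 1) :
    ∃ t ∈ Ioo (0 : ℝ) 1, score c n t = score c n u ∧
      u + (n : ℝ)⁻¹ ≤ 4 * t ∧ 1 - u + (n : ℝ)⁻¹ ≤ 4 * (1 - t) := by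
  have hn0 : (0 : ℝ) < n := Nat.cast_pos.2 hn
  obtain ⟨h1, h2⟩ := Finset.mem_Icc.1 (natCeil_mul_mem_Icc hn hu)
  set j := ⌈(n : ℝ) * u⌉₊
  have hlt : (j : ℝ) < n * u + 1 := Nat.ceil_lt_add_one (mul_pos hn0 hu.1).le
  have hle : n * u ≤ j := Nat.le_ceil _
  have h1' : (1 : ℝ) ≤ j := Nat.one_le_cast.2 h1
  have h2' : (j : ℝ) ≤ n := Nat.cast_le.2 h2
  have hmul : n * ((j - 1 / 2 : ℝ) / n) = j - 1 / 2 := mul_div_cancel₀ _ hn0.ne'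
  have hinv : n * (n : ℝ)⁻¹ = 1 := mul_inv_cancel₀ hn0.ne'
  refine ⟨(j - 1 / 2) / n, ⟨div_pos (by linarith) hn0, (div_lt_one hn0).2 (by linarith)⟩,
    ?_, ?_, ?_⟩
  · have hceil : ⌈(j - 1 / 2 : ℝ)⌉₊ = j :=
      (Nat.ceil_eq_iff (by omega)).2 ⟨by push_cast [h1]; linarith, by linarith⟩
    rw [score, score, hmul, hceil]
  · refine le_of_mul_le_mul_left ?_ hn0
    linarith
  · refine le_of_mul_le_mul_left ?_ hn0
    linarith

end Score

section Bounds

variable {M b₁ b₂ δ η s p t C : ℝ}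

theorem rpow_mul_rpow_neg_le {β : ℝ} (hp : p ∈ Ioo (0 : ℝ) 1) (ht : 0 < t) (hβ : 0 ≤ β)
    (hpt : p ^ (1 + η) ≤ C * t) (hs : 1 - δ + β * η ≤ s) :
    p ^ (-1 + β + δ) * t ^ (-β) ≤ C ^ β * p ^ (-s) := by
  have hC : 0 ≤ C := nonneg_of_mul_nonneg_left ((Real.rpow_nonneg hp.1.le _).trans hpt) ht
  have hpow : p ^ ((1 + η) * β) ≤ C ^ β * t ^ β := by
    rw [Real.rpow_mul hp.1.le, ← Real.mul_rpow hC ht.le]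
    exact Real.rpow_le_rpow (Real.rpow_nonneg hp.1.le _) hpt hβ
  calc p ^ (-1 + β + δ) * t ^ (-β)
      = p ^ (-(1 - δ + β * η)) * (p ^ ((1 + η) * β) * t ^ (-β)) := by
        rw [← mul_assoc, ← Real.rpow_add hp.1]
        ring_nf
    _ ≤ p ^ (-s) * (C ^ β * t ^ β * t ^ (-β)) := by
        have := Real.rpow_nonneg ht.le (-β)
        have := hp.1
        gcongr ?_ * (?_ * _)
        exact Real.rpow_le_rpow_of_exponent_ge hp.1 hp.2.le (neg_le_neg hs)
    _ = C ^ β * p ^ (-s) := by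
        rw [mul_assoc (C ^ β), ← Real.rpow_add ht, add_neg_cancel, Real.rpow_zero]
        ring

theorem boundD_mul_boundB_le (hb₁ : 0 ≤ b₁) (hb₂ : 0 ≤ b₂) (hp : p ∈ Ioo (0 : ℝ) 1)
    (ht : t ∈ Ioo (0 : ℝ) 1) (hs₁ : 1 - δ + b₁ * η ≤ s) (hs₂ : 1 - δ + b₂ * η ≤ s)
    (h₁ : p ^ (1 + η) ≤ C * t) (h₂ : (1 - p) ^ (1 + η) ≤ C * (1 - t)) :
    boundD M b₁ b₂ δ p * boundB M b₁ b₂ t ≤ M ^ 2 * (C ^ b₁ * C ^ b₂) * weight s p := by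
  have hp' : 1 - p ∈ Ioo (0 : ℝ) 1 := ⟨sub_pos.2 hp.2, by linarith [hp.1]⟩
  have ht' := sub_pos.2 ht.2
  have hleft := rpow_mul_rpow_neg_le hp ht.1 hb₁ h₁ hs₁
  have hright := rpow_mul_rpow_neg_le hp' ht' hb₂ h₂ hs₂
  have hprod := mul_le_mul hleft hright
    (mul_nonneg (Real.rpow_nonneg hp'.1.le _) (Real.rpow_nonneg ht'.le _))
    ((mul_nonneg (Real.rpow_nonneg hp.1.le _) (Real.rpow_nonneg ht.1.le _)).trans hleft)
  rw [weight_of_mem hp, boundD, boundB]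
  linarith [mul_le_mul_of_nonneg_left hprod (sq_nonneg M)]

theorem boundD_le_weight (hp : p ∈ Ioo (0 : ℝ) 1) (hs₁ : 1 - δ - b₁ ≤ s) (hs₂ : 1 - δ - b₂ ≤ s) :
    boundD M b₁ b₂ δ p ≤ |M| * weight s p := by
  have h0 := hp.1
  have h1 := sub_pos.2 hp.2
  rw [weight_of_mem hp, boundD, mul_assoc]
  gcongr ?_ * (?_ * ?_)
  · exact le_abs_self M
  · exact Real.rpow_le_rpow_of_exponent_ge h0 hp.2.le (by linarith)
  · exact Real.rpow_le_rpow_of_exponent_ge h1 (by linarith) (by linarith)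

end Bounds

section L1Convergence

variable {α : Type*} [MeasurableSpace α] {μ : Measure α}

theorem tendsto_integral_sub_integral_of_lintegral_enorm_sub {F G : ℕ → α → ℝ}
    (hF : ∀ n, AEStronglyMeasurable (F n) μ) (hG : ∀ᶠ n in atTop, Integrable (G n) μ)
    (h : Tendsto (fun n => ∫⁻ a, ‖F n a - G n a‖ₑ ∂μ) atTop (𝓝 0)) :
    Tendsto (fun n => ∫ a, F n a ∂μ - ∫ a, G n a ∂μ) atTop (𝓝 0) := by
  rw [tendsto_zero_iff_enorm_tendsto_zero]
  refine tendsto_of_tendsto_of_tendsto_of_le_of_le' tendsto_const_nhds h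
    (Eventually.of_forall fun _ => zero_le) ?_
  filter_upwards [hG, h.eventually_lt_const ENNReal.zero_lt_top] with n hGn hn
  have hsub : Integrable (F n - G n) μ := ⟨(hF n).sub hGn.1, hn⟩
  have hFn : Integrable (F n) μ := by simpa using hsub.add hGn
  rw [← integral_sub hFn hGn]
  exact enorm_integral_le_lintegral_enorm _

theorem tendsto_setLIntegral_lt_enorm {B : α → ℝ} (hB : AEMeasurable B μ) {w : α → ℝ≥0∞}
    (hw : AEMeasurable w μ) (hwfin : ∫⁻ a, w a ∂μ ≠ ∞) :
    Tendsto (fun L : ℕ => ∫⁻ a, {a | (L : ℝ≥0∞) < ‖B a‖ₑ}.indicator w a ∂μ) atTop (𝓝 0) := by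
  rw [← lintegral_zero (μ := μ)]
  refine tendsto_lintegral_of_dominated_convergence' w (fun L => ?_)
    (fun L => Eventually.of_forall (indicator_le_self _ w)) hwfin
    (Eventually.of_forall fun a => tendsto_const_nhds.congr' ?_)
  · exact hw.indicator₀ (nullMeasurableSet_lt aemeasurable_const hB.enorm)
  · obtain ⟨L, hL⟩ := ENNReal.exists_nat_gt (enorm_ne_top (x := B a))
    filter_upwards [eventually_ge_atTop L] with N hN
    have hLN : (L : ℝ≥0∞) ≤ N := Nat.cast_le.2 hN
    have ha : a ∉ {a | (N : ℝ≥0∞) < ‖B a‖ₑ} := (hL.le.trans hLN).not_gt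
    exact (indicator_of_notMem ha w).symm

theorem tendsto_lintegral_min_enorm_mul {B : α → ℝ} (hB : AEMeasurable B μ) {w : α → ℝ≥0∞}
    (hw : AEMeasurable w μ) (hwfin : ∫⁻ a, w a ∂μ ≠ ∞) {h : ℕ → α → ℝ≥0∞}
    (hh : Tendsto (fun n => ∫⁻ a, h n a ∂μ) atTop (𝓝 0)) :
    Tendsto (fun n => ∫⁻ a, min (‖B a‖ₑ * h n a) (w a) ∂μ) atTop (𝓝 0) := by
  refine ENNReal.tendsto_nhds_zero.2 fun ε hε => ?_
  have hε2 : 0 < ε / 2 := ENNReal.half_pos hε.ne'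
  obtain ⟨L, hL⟩ := (ENNReal.tendsto_nhds_zero.1
    (tendsto_setLIntegral_lt_enorm hB hw hwfin) _ hε2).exists
  have hLh : Tendsto (fun n => L * ∫⁻ a, h n a ∂μ) atTop (𝓝 0) := by
    simpa using ENNReal.Tendsto.const_mul hh (Or.inr (ENNReal.natCast_ne_top L))
  filter_upwards [ENNReal.tendsto_nhds_zero.1 hLh _ hε2] with n hn
  have hsplit (a : α) : min (‖B a‖ₑ * h n a) (w a) ≤
      L * h n a + {a | (L : ℝ≥0∞) < ‖B a‖ₑ}.indicator w a := by
    rcases lt_or_ge (L : ℝ≥0∞) ‖B a‖ₑ with ha | ha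
    · rw [indicator_of_mem (show a ∈ {a | (L : ℝ≥0∞) < ‖B a‖ₑ} from ha)]
      exact (min_le_right _ _).trans le_add_self
    · exact (min_le_left _ _).trans ((mul_le_mul_left ha _).trans le_self_add)
  calc ∫⁻ a, min (‖B a‖ₑ * h n a) (w a) ∂μ
      ≤ ∫⁻ a, (L * h n a + {a | (L : ℝ≥0∞) < ‖B a‖ₑ}.indicator w a) ∂μ := lintegral_mono hsplit
    _ = L * ∫⁻ a, h n a ∂μ + ∫⁻ a, {a | (L : ℝ≥0∞) < ‖B a‖ₑ}.indicator w a ∂μ := by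
        rw [lintegral_add_right' _
          (hw.indicator₀ (nullMeasurableSet_lt aemeasurable_const hB.enorm)),
          lintegral_const_mul' _ _ (ENNReal.natCast_ne_top L)]
    _ ≤ ε / 2 + ε / 2 := add_le_add hn hL
    _ = ε := ENNReal.add_halves ε

variable [IsFiniteMeasure μ] {G : ℕ → α → ℝ} {H : α → ℝ}

theorem tendsto_lintegral_enorm_comp_sub_of_continuous {φ : ℝ → ℝ} (hφ : Continuous φ)
    (hφ' : HasCompactSupport φ) (hG : ∀ n, AEMeasurable (G n) μ) (hH : AEMeasurable H μ)
    (hlim : ∀ᵐ a ∂μ, Tendsto (G · a) atTop (𝓝 (H a))) :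
    Tendsto (fun n => ∫⁻ a, ‖φ (G n a) - φ (H a)‖ₑ ∂μ) atTop (𝓝 0) := by
  obtain ⟨K, hK⟩ := hφ'.exists_bound_of_continuous hφ
  have hbound (t : ℝ) : ‖φ t‖ₑ ≤ ENNReal.ofReal K := by
    rw [← ofReal_norm]
    exact ENNReal.ofReal_le_ofReal (hK t)
  rw [← lintegral_zero (μ := μ)]
  refine tendsto_lintegral_of_dominated_convergence'
    (fun _ => ENNReal.ofReal K + ENNReal.ofReal K)
    (fun n => ((hφ.measurable.comp_aemeasurable (hG n)).sub
      (hφ.measurable.comp_aemeasurable hH)).enorm)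
    (fun n => Eventually.of_forall fun a => enorm_sub_le.trans (add_le_add (hbound _) (hbound _)))
    (by simp [ENNReal.mul_eq_top]) ?_
  filter_upwards [hlim] with a ha
  simpa using (((hφ.tendsto _).comp ha).sub_const (φ (H a))).enorm

theorem tendsto_lintegral_enorm_comp_sub {f : ℝ → ℝ} (hf : Measurable f)
    (hG : ∀ n, AEMeasurable (G n) μ) (hH : AEMeasurable H μ)
    (hlim : ∀ᵐ a ∂μ, Tendsto (G · a) atTop (𝓝 (H a)))
    (happrox : ∀ ε : ℝ, 0 < ε → ∃ φ : ℝ → ℝ, Continuous φ ∧ HasCompactSupport φ ∧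
      ∫⁻ a, ‖f (H a) - φ (H a)‖ₑ ∂μ ≤ ENNReal.ofReal ε ∧
      ∀ᶠ n in atTop, ∫⁻ a, ‖f (G n a) - φ (G n a)‖ₑ ∂μ ≤ ENNReal.ofReal ε) :
    Tendsto (fun n => ∫⁻ a, ‖f (G n a) - f (H a)‖ₑ ∂μ) atTop (𝓝 0) := by
  refine ENNReal.tendsto_nhds_zero.2 fun ε hε => ?_
  obtain ⟨r, -, hr0, hr⟩ := ENNReal.lt_iff_exists_real_btwn.1
    (ENNReal.div_pos hε.ne' (ENNReal.ofNat_ne_top (n := 3)))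
  obtain ⟨φ, hφ, hφ', hfφ, hfφn⟩ := happrox r (ENNReal.ofReal_pos.1 hr0)
  filter_upwards [hfφn, ENNReal.tendsto_nhds_zero.1
    (tendsto_lintegral_enorm_comp_sub_of_continuous hφ hφ' hG hH hlim) _ hr0] with n h1 h2
  have htriangle (a : α) : ‖f (G n a) - f (H a)‖ₑ ≤ ‖f (G n a) - φ (G n a)‖ₑ +
      (‖φ (G n a) - φ (H a)‖ₑ + ‖f (H a) - φ (H a)‖ₑ) := by
    rw [← enorm_neg (f (H a) - φ (H a))]
    refine le_trans ?_ ((enorm_add_le _ _).trans (by gcongr; exact enorm_add_le _ _))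
    exact le_of_eq (congrArg _ (by ring))
  have hφH : AEMeasurable (fun a => ‖f (H a) - φ (H a)‖ₑ) μ :=
    ((hf.sub hφ.measurable).comp_aemeasurable hH).enorm
  have hfG : AEMeasurable (fun a => ‖f (G n a) - φ (G n a)‖ₑ) μ :=
    ((hf.sub hφ.measurable).comp_aemeasurable (hG n)).enorm
  calc ∫⁻ a, ‖f (G n a) - f (H a)‖ₑ ∂μ
      ≤ ∫⁻ a, ‖f (G n a) - φ (G n a)‖ₑ ∂μ +
        (∫⁻ a, ‖φ (G n a) - φ (H a)‖ₑ ∂μ + ∫⁻ a, ‖f (H a) - φ (H a)‖ₑ ∂μ) := by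
        rw [← lintegral_add_right' _ hφH, ← lintegral_add_left' hfG]
        exact lintegral_mono htriangle
    _ ≤ ε / 3 + (ε / 3 + ε / 3) :=
        add_le_add (h1.trans hr.le) (add_le_add (h2.trans hr.le) (hfφ.trans hr.le))
    _ = ε := by rw [← add_assoc, ENNReal.add_thirds]

end L1Convergence

section StableApproximation

/-- `f` is a limit of test functions simultaneously in `L¹` of Lebesgue measure and, uniformly over
all large `n`, in `L¹` of the smoothed empirical measures of `x`. This allows passing to the limit
in `f` along empirical quantiles even though `f` is neither continuous nor bounded. -/
def IsStablyApproximable (κ : ℕ → Measure ℝ) (x : ℕ → ℝ) (f : ℝ → ℝ) : Prop :=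
  ∀ ε : ℝ, 0 < ε → ∃ φ : ℝ → ℝ, Continuous φ ∧ HasCompactSupport φ ∧
    ∫⁻ t, ‖f t - φ t‖ₑ ≤ ENNReal.ofReal ε ∧
    ∀ᶠ n in atTop, ∫⁻ t, ‖f t - φ t‖ₑ ∂(empMeasure n x ∗ κ n) ≤ ENNReal.ofReal ε

theorem tendsto_lintegral_enorm_comp_leftInv_sub {κ : ℕ → Measure ℝ}
    [∀ n, IsProbabilityMeasure (κ n)] (hκ : IsVanishingNoise κ) {x : ℕ → ℝ} {η : ℝ}
    (hx : IsTypicalPath η x) {f : ℝ → ℝ} (hf : Measurable f) (hfx : IsStablyApproximable κ x f) :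
    Tendsto (fun n => ∫⁻ u in Ioo 0 1, ‖f (leftInv (cdf (empMeasure n x ∗ κ n)) u) - f u‖ₑ)
      atTop (𝓝 0) := by
  refine tendsto_lintegral_enorm_comp_sub hf (fun n => aemeasurable_leftInv_cdf _) aemeasurable_id
    ((ae_restrict_iff' measurableSet_Ioo).2 (Eventually.of_forall fun u hu =>
      hx.tendsto_leftInv hκ hu)) fun ε hε => ?_
  obtain ⟨φ, hφ, hφ', hfφ, hfφn⟩ := hfx ε hε
  refine ⟨φ, hφ, hφ', (setLIntegral_le_lintegral _ _).trans hfφ, ?_⟩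
  filter_upwards [hfφn, eventually_ne_atTop 0] with n hn hn0
  have : NeZero n := ⟨hn0⟩
  rwa [lintegral_comp_leftInv_cdf _ (f := fun t => ‖f t - φ t‖ₑ) (hf.sub hφ.measurable).enorm]

variable {Ω : Type*} [MeasurableSpace Ω] {P : Measure Ω} {ξ : ℕ → Ω → ℝ} {κ : ℕ → Measure ℝ}
  {ν : Measure ℝ} {f : ℝ → ℝ}

theorem ae_isStablyApproximable_of_domination (hf : Integrable f)
    (hdom : ∀ φ : ℝ → ℝ, Continuous φ → HasCompactSupport φ → ∀ m : ℝ, 0 < m →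
      ∫⁻ t, ‖f t - φ t‖ₑ ≤ ENNReal.ofReal m → ∀ᵐ ω ∂P, ∀ᶠ n in atTop,
        ∫⁻ t, ‖f t - φ t‖ₑ ∂(empMeasure n (fun i => ξ i ω) ∗ κ n) ≤ ENNReal.ofReal (4 * m)) :
    ∀ᵐ ω ∂P, IsStablyApproximable κ (fun i => ξ i ω) f := by
  have hpos (j : ℕ) : (0 : ℝ) < 1 / (j + 1) / 4 := by positivity
  choose φ hφ' hfφ hφ _ using fun j => hf.exists_hasCompactSupport_lintegral_sub_le
    (ENNReal.ofReal_pos.2 (hpos j)).ne'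
  filter_upwards [ae_all_iff.2 fun j => hdom _ (hφ j) (hφ' j) _ (hpos j) (hfφ j)] with ω hω
  intro ε hε
  obtain ⟨j, hj⟩ := exists_nat_one_div_lt hε
  refine ⟨φ j, hφ j, hφ' j, (hfφ j).trans (ENNReal.ofReal_le_ofReal ?_), ?_⟩
  · linarith [hpos j]
  · filter_upwards [hω j] with n hn
    exact hn.trans (ENNReal.ofReal_le_ofReal (by linarith))

theorem ae_isStablyApproximable_of_le_smul_volume (hmeas : ∀ i, Measurable (ξ i))
    (hind : iIndepFun ξ P) (hlaw : ∀ i, P.map (ξ i) = ν) (hν : ν ≤ volume)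
    [∀ n, IsProbabilityMeasure (κ n)] {C : ℝ} (hC : 0 ≤ C)
    (hκ : ∀ᶠ n : ℕ in atTop, κ n ≤ ENNReal.ofReal (C * n) • volume) {q : ℝ} (hq : 1 < q)
    (hf : Measurable f) (hf1 : Integrable f) (hfq : MemLp f (ENNReal.ofReal q)) :
    ∀ᵐ ω ∂P, IsStablyApproximable κ (fun i => ξ i ω) f := by
  refine ae_isStablyApproximable_of_domination hf1 fun φ hφ hφ' m hm hfm => ?_
  have hfφ : MemLp (f - φ) (ENNReal.ofReal q) := hfq.sub (hφ.memLp_of_hasCompactSupport hφ')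
  refine ae_eventually_lintegral_empMeasure_conv_le hmeas hind hlaw hν hC hκ hq
    (hf.sub hφ.measurable).enorm ?_ hm hfm
  simpa [ENNReal.toReal_ofReal (zero_lt_one.trans hq).le] using
    (lintegral_rpow_enorm_lt_top_of_eLpNorm_lt_top (by simpa using zero_lt_one.trans hq)
      ENNReal.ofReal_ne_top hfφ.2).ne

theorem ae_isStablyApproximable_dirac_zero (hmeas : ∀ i, Measurable (ξ i)) (hind : iIndepFun ξ P)
    (hlaw : ∀ i, P.map (ξ i) = ν) (hν : ν ≤ volume) (hf : Measurable f) (hf1 : Integrable f) :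
    ∀ᵐ ω ∂P, IsStablyApproximable (fun _ => Measure.dirac 0) (fun i => ξ i ω) f := by
  refine ae_isStablyApproximable_of_domination hf1 fun φ hφ _ m hm hfm => ?_
  simpa only [Measure.conv_dirac_zero, Pi.sub_apply] using
    ae_eventually_lintegral_empMeasure_le hmeas hind hlaw (hf.sub hφ.measurable) hm
      ((lintegral_mono' hν le_rfl).trans hfm)

end StableApproximation

section Convergence

variable {g : ℝ → ℝ} {c : ℕ → ℕ → ℝ} {M b₁ b₂ δ η s : ℝ}

theorem integrableOn_mul_score {f : ℝ → ℝ} (hf : IntegrableOn f (Ioo 0 1)) (c : ℕ → ℕ → ℝ)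
    (n : ℕ) : IntegrableOn (fun u => f u * score c n u) (Ioo 0 1) := by
  obtain ⟨C, hC⟩ := exists_abs_score_le c n
  exact Integrable.mul_bdd hf (measurable_score c n).aestronglyMeasurable
    ((ae_restrict_iff' measurableSet_Ioo).2 (Eventually.of_forall hC))

theorem memLp_indicator_of_abs_le_boundD (hg : ∀ t ∈ Ioo (0 : ℝ) 1, |g t| ≤ boundD M b₁ b₂ δ t)
    (hgm : Measurable ((Ioo 0 1).indicator g)) (hs₁ : 1 - δ - b₁ ≤ s) (hs₂ : 1 - δ - b₂ ≤ s)
    {q : ℝ} (hq : 0 < q) (hs : s * q < 1) :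
    MemLp ((Ioo 0 1).indicator g) (ENNReal.ofReal q) := by
  refine ((memLp_weight hq hs).const_mul |M|).mono hgm.aestronglyMeasurable
    (Eventually.of_forall fun t => ?_)
  by_cases ht : t ∈ Ioo (0 : ℝ) 1
  · rw [indicator_of_mem ht]
    exact ((hg t ht).trans (boundD_le_weight ht hs₁ hs₂)).trans (le_abs_self _)
  · rw [indicator_of_notMem ht, norm_zero]
    exact norm_nonneg _

theorem integrable_indicator_of_abs_le_boundD (hb₁ : 0 ≤ b₁) (hb₂ : 0 ≤ b₂) (hδ : 0 < δ)
    (hg : ∀ t ∈ Ioo (0 : ℝ) 1, |g t| ≤ boundD M b₁ b₂ δ t)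
    (hgm : Measurable ((Ioo 0 1).indicator g)) : Integrable ((Ioo 0 1).indicator g) := by
  rw [← memLp_one_iff_integrable, ← ENNReal.ofReal_one]
  exact memLp_indicator_of_abs_le_boundD (s := 1 - δ) hg hgm (by linarith) (by linarith) one_pos
    (by linarith)

theorem abs_indicator_mul_score_le (hb₁ : 0 ≤ b₁) (hb₂ : 0 ≤ b₂)
    (hg : ∀ t ∈ Ioo (0 : ℝ) 1, |g t| ≤ boundD M b₁ b₂ δ t) {n : ℕ} (hn : 0 < n)
    (hc : ∀ t ∈ Ioo (0 : ℝ) 1, |score c n t| ≤ boundB M b₁ b₂ t)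
    (hs₁ : 1 - δ + b₁ * η ≤ s) (hs₂ : 1 - δ + b₂ * η ≤ s) {C p u : ℝ} (hC : 0 ≤ C)
    (hu : u ∈ Ioo (0 : ℝ) 1) (hpu : p ∈ Ioo (0 : ℝ) 1 → p ^ (1 + η) ≤ C * (u + (n : ℝ)⁻¹) ∧
      (1 - p) ^ (1 + η) ≤ C * (1 - u + (n : ℝ)⁻¹)) :
    |(Ioo (0 : ℝ) 1).indicator g p * score c n u| ≤
      M ^ 2 * ((C * 4) ^ b₁ * (C * 4) ^ b₂) * weight s p := by
  by_cases hp : p ∈ Ioo (0 : ℝ) 1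
  · obtain ⟨t, ht, hscore, h0, h1⟩ := exists_score_eq_of_pos c hn hu
    rw [indicator_of_mem hp, ← hscore, abs_mul]
    refine (mul_le_mul (hg p hp) (hc t ht) (abs_nonneg _) ((abs_nonneg _).trans (hg p hp))).trans
      (boundD_mul_boundB_le hb₁ hb₂ hp ht hs₁ hs₂ ((hpu hp).1.trans ?_) ((hpu hp).2.trans ?_))
    · rw [mul_assoc]
      gcongr
    · rw [mul_assoc]
      gcongr
  · simp [weight, indicator_of_notMem hp]

theorem enorm_mul_sub_mul_le_add_min {a a' j B v v' : ℝ} {K : ℝ≥0∞} (h : ‖a * j‖ₑ ≤ K * ‖v‖ₑ)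
    (h' : ‖a' * j‖ₑ ≤ K * ‖v'‖ₑ) (hj : ‖j‖ₑ ≤ ‖B‖ₑ) :
    ‖a * j - a' * j‖ₑ ≤ K * ‖v - v'‖ₑ + min (‖B‖ₑ * ‖a - a'‖ₑ) (2 * K * ‖v'‖ₑ) := by
  rw [min_def]
  split_ifs
  · rw [← sub_mul, enorm_mul, mul_comm]
    exact (mul_le_mul_left hj _).trans le_add_self
  · have hv : ‖v‖ₑ ≤ ‖v - v'‖ₑ + ‖v'‖ₑ := by simpa using enorm_add_le (v - v') v'
    calc ‖a * j - a' * j‖ₑ ≤ K * ‖v‖ₑ + K * ‖v'‖ₑ := enorm_sub_le.trans (add_le_add h h')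
      _ ≤ K * (‖v - v'‖ₑ + ‖v'‖ₑ) + K * ‖v'‖ₑ := by gcongr
      _ = K * ‖v - v'‖ₑ + 2 * K * ‖v'‖ₑ := by ring

variable {κ : ℕ → Measure ℝ} [∀ n, IsProbabilityMeasure (κ n)] {x : ℕ → ℝ}

theorem exists_enorm_indicator_comp_leftInv_mul_score_le (hb₁ : 0 ≤ b₁) (hb₂ : 0 ≤ b₂)
    (hη : 0 ≤ η) (hg : ∀ t ∈ Ioo (0 : ℝ) 1, |g t| ≤ boundD M b₁ b₂ δ t)
    (hc : ∀ n, 1 ≤ n → ∀ t ∈ Ioo (0 : ℝ) 1, |score c n t| ≤ boundB M b₁ b₂ t)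
    (hs₁ : 1 - δ + b₁ * η ≤ s) (hs₂ : 1 - δ + b₂ * η ≤ s) (hκ : IsVanishingNoise κ)
    (hx : IsTypicalPath η x) :
    ∃ K : ℝ, ∀ᶠ n in atTop, ∀ u ∈ Ioo (0 : ℝ) 1,
      ‖(Ioo 0 1).indicator g (leftInv (cdf (empMeasure n x ∗ κ n)) u) * score c n u‖ₑ ≤
        ‖K‖ₑ * ‖weight s (leftInv (cdf (empMeasure n x ∗ κ n)) u)‖ₑ ∧
      ‖(Ioo 0 1).indicator g u * score c n u‖ₑ ≤ ‖K‖ₑ * ‖weight s u‖ₑ := by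
  obtain ⟨C, hC, hCx⟩ := hx.exists_rpow_leftInv_le hκ
  have hself {p r : ℝ} (hp : p ∈ Ioo (0 : ℝ) 1) (hr : 0 ≤ r) :
      p ^ (1 + η) ≤ (C + 1) * (p + r) := by
    calc p ^ (1 + η) ≤ p :=
          Real.rpow_le_self_of_le_one hp.1.le hp.2.le (le_add_of_nonneg_right hη)
      _ ≤ p + r := le_add_of_nonneg_right hr
      _ ≤ (C + 1) * (p + r) :=
          le_mul_of_one_le_left (add_nonneg hp.1.le hr) (le_add_of_nonneg_left hC)
  have henorm {a b d : ℝ} (h : |a| ≤ b * d) : ‖a‖ₑ ≤ ‖b‖ₑ * ‖d‖ₑ := by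
    rw [← enorm_mul, enorm_le_iff_norm_le, Real.norm_eq_abs]
    exact h.trans (le_abs_self _)
  refine ⟨M ^ 2 * (((C + 1) * 4) ^ b₁ * ((C + 1) * 4) ^ b₂), ?_⟩
  filter_upwards [hCx, eventually_gt_atTop 0] with n hCn hn u hu
  have hinv : (0 : ℝ) ≤ (n : ℝ)⁻¹ := by positivity
  have hu0 : 0 ≤ u + (n : ℝ)⁻¹ := add_nonneg hu.1.le hinv
  have hu1 : 0 ≤ 1 - u + (n : ℝ)⁻¹ := add_nonneg (sub_nonneg.2 hu.2.le) hinv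
  have hle : C ≤ C + 1 := le_add_of_nonneg_right zero_le_one
  refine ⟨henorm (abs_indicator_mul_score_le hb₁ hb₂ hg hn (hc n hn) hs₁ hs₂ (hC.trans hle) hu
      fun hp => ?_),
    henorm (abs_indicator_mul_score_le hb₁ hb₂ hg hn (hc n hn) hs₁ hs₂ (hC.trans hle) hu
      fun hp => ⟨hself hp hinv, hself ⟨sub_pos.2 hp.2, sub_lt_self _ hp.1⟩ hinv⟩)⟩
  exact ⟨(hCn u hu hp).1.trans (mul_le_mul_of_nonneg_right hle hu0),
    (hCn u hu hp).2.trans (mul_le_mul_of_nonneg_right hle hu1)⟩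

theorem tendsto_lintegral_enorm_mul_score_sub (hb₁ : 0 ≤ b₁) (hb₂ : 0 ≤ b₂) (hη : 0 ≤ η)
    (hg : ∀ t ∈ Ioo (0 : ℝ) 1, |g t| ≤ boundD M b₁ b₂ δ t)
    (hgm : Measurable ((Ioo 0 1).indicator g))
    (hc : ∀ n, 1 ≤ n → ∀ t ∈ Ioo (0 : ℝ) 1, |score c n t| ≤ boundB M b₁ b₂ t)
    (hs₁ : 1 - δ + b₁ * η ≤ s) (hs₂ : 1 - δ + b₂ * η ≤ s) (hs : s < 1)
    (hκ : IsVanishingNoise κ) (hx : IsTypicalPath η x)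
    (hgx : IsStablyApproximable κ x ((Ioo 0 1).indicator g))
    (hwx : IsStablyApproximable κ x (weight s)) :
    Tendsto (fun n => ∫⁻ u in Ioo 0 1,
      ‖(Ioo 0 1).indicator g (leftInv (cdf (empMeasure n x ∗ κ n)) u) * score c n u -
        (Ioo 0 1).indicator g u * score c n u‖ₑ) atTop (𝓝 0) := by
  obtain ⟨K, hK⟩ :=
    exists_enorm_indicator_comp_leftInv_mul_score_le hb₁ hb₂ hη hg hc hs₁ hs₂ hκ hx
  have hBm : Measurable (boundB M b₁ b₂) := by
    unfold boundB
    fun_prop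
  have hwfin : ∫⁻ u in Ioo 0 1, 2 * ‖K‖ₑ * ‖weight s u‖ₑ ≠ ∞ := by
    rw [lintegral_const_mul _ measurable_weight.enorm]
    exact (ENNReal.mul_lt_top (by simp [ENNReal.mul_lt_top])
      (integrable_weight hs).integrableOn.2).ne
  have hsmall := (ENNReal.Tendsto.const_mul (a := ‖K‖ₑ)
    (tendsto_lintegral_enorm_comp_leftInv_sub hκ hx measurable_weight hwx)
    (Or.inr enorm_ne_top)).add
    (tendsto_lintegral_min_enorm_mul hBm.aemeasurable
      (measurable_weight.enorm.const_mul _).aemeasurable hwfin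
      (tendsto_lintegral_enorm_comp_leftInv_sub hκ hx hgm hgx))
  rw [mul_zero, add_zero] at hsmall
  refine tendsto_of_tendsto_of_tendsto_of_le_of_le' tendsto_const_nhds hsmall
    (Eventually.of_forall fun _ => zero_le) ?_
  filter_upwards [hK, eventually_ge_atTop 1] with n hKn hn
  have hdiff : AEMeasurable (fun u => ‖K‖ₑ *
      ‖weight s (leftInv (cdf (empMeasure n x ∗ κ n)) u) - weight s u‖ₑ)
      (volume.restrict (Ioo 0 1)) :=
    ((measurable_weight.comp_aemeasurable (aemeasurable_leftInv_cdf _)).sub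
      measurable_weight.aemeasurable).enorm.const_mul _
  rw [← lintegral_const_mul' _ _ enorm_ne_top, ← lintegral_add_left' hdiff]
  refine setLIntegral_mono' measurableSet_Ioo fun u hu => ?_
  refine enorm_mul_sub_mul_le_add_min (hKn u hu).1 (hKn u hu).2 (enorm_le_iff_norm_le.2 ?_)
  exact (hc n hn u hu).trans (le_abs_self _)

theorem tendsto_setIntegral_comp_leftInv_mul_score_sub_centerMu (hb₁ : 0 ≤ b₁) (hb₂ : 0 ≤ b₂)
    (hη : 0 ≤ η) (hg : ∀ t ∈ Ioo (0 : ℝ) 1, |g t| ≤ boundD M b₁ b₂ δ t)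
    (hgm : Measurable ((Ioo 0 1).indicator g))
    (hc : ∀ n, 1 ≤ n → ∀ t ∈ Ioo (0 : ℝ) 1, |score c n t| ≤ boundB M b₁ b₂ t)
    (hs₁ : 1 - δ + b₁ * η ≤ s) (hs₂ : 1 - δ + b₂ * η ≤ s) (hs : s < 1)
    (hκ : IsVanishingNoise κ) (hx : IsTypicalPath η x)
    (hgx : IsStablyApproximable κ x ((Ioo 0 1).indicator g))
    (hwx : IsStablyApproximable κ x (weight s)) :
    Tendsto (fun n => (∫ u in Ioo 0 1,
      (Ioo 0 1).indicator g (leftInv (cdf (empMeasure n x ∗ κ n)) u) * score c n u) -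
        centerMu g c n) atTop (𝓝 0) := by
  have hgi := integrable_indicator_of_abs_le_boundD hb₁ hb₂ (by nlinarith) hg hgm
  have hcenter (n : ℕ) :
      centerMu g c n = ∫ u in Ioo 0 1, (Ioo 0 1).indicator g u * score c n u :=
    setIntegral_congr_fun measurableSet_Ioo fun u hu => by simp only [indicator_of_mem hu]
  simp only [hcenter]
  exact tendsto_integral_sub_integral_of_lintegral_enorm_sub (F := fun n u =>
      (Ioo 0 1).indicator g (leftInv (cdf (empMeasure n x ∗ κ n)) u) * score c n u)
    (fun n => ((hgm.comp_aemeasurable (aemeasurable_leftInv_cdf _)).mul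
      (measurable_score c n).aemeasurable).aestronglyMeasurable)
    (Eventually.of_forall fun n => integrableOn_mul_score hgi.integrableOn c n)
    (tendsto_lintegral_enorm_mul_score_sub hb₁ hb₂ hη hg hgm hc hs₁ hs₂ hs hκ hx hgx hwx)

end Convergence

section KernelAndBandwidth

variable {k : ℝ → ℝ} {b : ℕ → ℝ}

theorem setIntegral_Iic_zero_pos (hk0 : ∀ x, 0 ≤ k x) (hk1 : ∫ x, k x ≠ 0)
    (hmean : ∫ x, x * k x = 0) (hxk : Integrable fun x => x * k x) :
    0 < ∫ x in Iic 0, k x := by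
  refine (integral_nonneg hk0).lt_of_ne' fun h0 => hk1 ?_
  have hneg : ∀ᵐ x, x ∈ Iic (0 : ℝ) → k x = 0 := (ae_restrict_iff' measurableSet_Iic).1
    ((integral_eq_zero_iff_of_nonneg hk0 (Integrable.of_integral_ne_zero hk1).integrableOn).1 h0)
  have hxk0 : ∀ᵐ x, x * k x = 0 := by
    refine (integral_eq_zero_iff_of_nonneg_ae ?_ hxk).1 hmean
    filter_upwards [hneg] with x hx
    rcases le_or_gt x 0 with h | h
    · simp [hx h]
    · exact mul_nonneg h.le (hk0 x)
  refine integral_eq_zero_of_ae ?_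
  filter_upwards [hneg, hxk0] with x hx hx'
  exact (mul_eq_zero.1 hx').elim (fun h => hx h.le) id

theorem IsKernel.kernelDF_zero_mem_Ioo (hk : IsKernel k) : kernelDF k 0 ∈ Ioo 0 1 := by
  refine ⟨setIntegral_Iic_zero_pos hk.nonneg (by simp [hk.integral_eq_one]) hk.mean_eq_zero
    hk.integrable_mean, ?_⟩
  have hneg : (fun x => x * k (-x)) = -fun x => -x * k (-x) := by
    funext x
    simp
  have hupper : 0 < ∫ x in Iic 0, k (-x) := by
    refine setIntegral_Iic_zero_pos (fun x => hk.nonneg (-x)) ?_ ?_ ?_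
    · rw [integral_neg_eq_self k volume, hk.integral_eq_one]
      exact one_ne_zero
    · rw [hneg, integral_neg', integral_neg_eq_self (fun x => x * k x) volume, hk.mean_eq_zero,
        neg_zero]
    · rw [hneg]
      exact hk.integrable_mean.comp_neg.neg
  rw [integral_comp_neg_Iic, neg_zero] at hupper
  have hsum := intervalIntegral.integral_Iic_add_Ioi (b := (0 : ℝ)) hk.integrable.integrableOn
    hk.integrable.integrableOn
  rw [hk.integral_eq_one] at hsum
  rw [kernelDF]
  linarith

theorem IsBandwidth.isBigO_inv (hb : IsBandwidth b) :
    (fun n => (b n)⁻¹) =O[atTop] fun n : ℕ => (n : ℝ) := by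
  refine Asymptotics.IsBigO.of_bound 1 ?_
  filter_upwards [hb.tendsto_atTop.eventually_ge_atTop 1, eventually_ge_atTop 1] with n h1 hn
  have hbn := hb.pos n hn
  rw [Real.norm_of_nonneg (inv_pos.2 hbn).le, Real.norm_natCast, one_mul]
  exact (inv_le_iff_one_le_mul₀ hbn).2 h1

theorem isVanishingNoise_kernelLaw (hk0 : ∀ x, 0 ≤ k x) (hk1 : ∫ x, k x = 1)
    (hk00 : kernelDF k 0 ∈ Ioo 0 1) (hb : ∀ n, 1 ≤ n → 0 < b n) (hb0 : Tendsto b atTop (𝓝 0)) :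
    IsVanishingNoise fun n => kernelLaw k (b n) := by
  have := isProbabilityMeasure_withDensity_ofReal hk0 hk1
  have hIic := measureReal_withDensity_Iic hk0 (integrable_of_integral_eq_one hk1) 0
  refine isVanishingNoise_map_mul (hIic ▸ hk00.1) ?_ ((eventually_ge_atTop 1).mono hb) hb0
  have hIoi := probReal_compl_eq_one_sub (μ := volume.withDensity fun z => ENNReal.ofReal (k z))
    (measurableSet_Iic (a := (0 : ℝ)))
  rw [compl_Iic, hIic] at hIoi
  exact (sub_pos.2 hk00.2).trans_le (hIoi ▸ measureReal_mono Ioi_subset_Ici_self)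

theorem exists_eventually_kernelLaw_le_smul_volume {A : ℝ} (hA : 0 ≤ A) (hkA : ∀ x, k x ≤ A)
    (hb : ∀ n, 1 ≤ n → 0 < b n) (hbO : (fun n => (b n)⁻¹) =O[atTop] fun n : ℕ => (n : ℝ)) :
    ∃ C, 0 ≤ C ∧ ∀ᶠ n : ℕ in atTop, kernelLaw k (b n) ≤ ENNReal.ofReal (C * n) • volume := by
  obtain ⟨B, hB, hbB⟩ := hbO.exists_nonneg
  refine ⟨A * B, mul_nonneg hA hB, ?_⟩
  filter_upwards [hbB.bound, eventually_ge_atTop 1] with n hn h1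
  refine (kernelLaw_le_smul_volume hkA (hb n h1)).trans
    (Measure.le_iff.2 fun t _ => mul_le_mul_left (ENNReal.ofReal_le_ofReal ?_) _)
  rw [Real.norm_of_nonneg (inv_pos.2 (hb n h1)).le, Real.norm_natCast] at hn
  rw [div_eq_mul_inv, mul_assoc]
  exact mul_le_mul_of_nonneg_left hn hA

end KernelAndBandwidth

section Statistics

variable {g : ℝ → ℝ} {c : ℕ → ℕ → ℝ} {M b₁ b₂ δ : ℝ}

theorem IsClassG.measurable_indicator (hg : IsClassG g) : Measurable ((Ioo 0 1).indicator g) := by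
  obtain ⟨p, q, hp, hq, hpq⟩ := hg.locallyBV.exists_monotoneOn_sub_monotoneOn
  have hsub : Measurable fun t : Ioo (0 : ℝ) 1 => g t := by
    have hp' : Monotone fun t : Ioo (0 : ℝ) 1 => p t := fun s t hst => hp s.2 t.2 hst
    have hq' : Monotone fun t : Ioo (0 : ℝ) 1 => q t := fun s t hst => hq s.2 t.2 hst
    rw [hpq]
    exact hp'.measurable.sub hq'.measurable
  rw [← piecewise_eq_indicator]
  exact hsub.dite (measurable_const (a := (0 : ℝ))) measurableSet_Ioo

theorem integrableOn_integrandT {k : ℝ → ℝ} (hk0 : ∀ x, 0 ≤ k x) (hk1 : ∫ x, k x = 1)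
    {A : ℝ} (hkA : ∀ x, k x ≤ A) {b : ℝ} (hb : 0 < b)
    (hgi : Integrable ((Ioo 0 1).indicator g)) (c : ℕ → ℕ → ℝ) {n : ℕ} (hn : 0 < n)
    (x : ℕ → ℝ) :
    IntegrableOn (integrandT g k c b n x) (Ioo 0 1) := by
  have : NeZero n := ⟨hn.ne'⟩
  have := isProbabilityMeasure_kernelLaw hk0 hk1 b
  have hgμ : Integrable ((Ioo 0 1).indicator g) (empMeasure n x ∗ kernelLaw k b) :=
    (hgi.smul_measure ENNReal.ofReal_ne_top).mono_measure
      (conv_le_smul_volume (kernelLaw_le_smul_volume hkA hb))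
  rw [← map_leftInv_cdf (empMeasure n x ∗ kernelLaw k b)] at hgμ
  unfold integrandT
  rw [kernelEst_eq_cdf hk0 hk1 hb]
  exact integrableOn_mul_score (hgμ.comp_aemeasurable (aemeasurable_leftInv_cdf _)) c n

theorem exists_exponents (hb₁ : 0 ≤ b₁) (hb₂ : 0 ≤ b₂) (hδ : 0 < δ) :
    ∃ η s q : ℝ, 0 < η ∧ s < 1 ∧ 1 < q ∧ s * q < 1 ∧ 1 - δ + b₁ * η ≤ s ∧ 1 - δ + b₂ * η ≤ s := by
  have hd : 0 < min (δ / 2) (1 / 2) := by positivity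
  have hdδ : min (δ / 2) (1 / 2) ≤ δ / 2 := min_le_left _ _
  have hη {β : ℝ} (hβ : β ≤ b₁ + b₂ + 1) : β * (δ / 2 / (b₁ + b₂ + 1)) ≤ δ / 2 := by
    rw [mul_div_left_comm]
    exact mul_le_of_le_one_right (by positivity) ((div_le_one (by positivity)).2 hβ)
  refine ⟨δ / 2 / (b₁ + b₂ + 1), 1 - min (δ / 2) (1 / 2), 1 + min (δ / 2) (1 / 2), by positivity,
    by linarith, by linarith, by nlinarith, ?_, ?_⟩
  · linarith [hη (show b₁ ≤ b₁ + b₂ + 1 by linarith)]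
  · linarith [hη (show b₂ ≤ b₁ + b₂ + 1 by linarith)]

variable {Ω : Type*} [MeasurableSpace Ω] {P : Measure Ω} {ξ : ℕ → Ω → ℝ}

theorem ae_tendsto_setIntegral_comp_leftInv_mul_score_sub_centerMu
    (hmeas : ∀ i, Measurable (ξ i)) (hind : iIndepFun ξ P)
    (hlaw : ∀ i, P.map (ξ i) = volume.restrict (Ioo 0 1)) (hb₁ : 0 ≤ b₁) (hb₂ : 0 ≤ b₂)
    (hδ : 0 < δ) (hg : ∀ t ∈ Ioo (0 : ℝ) 1, |g t| ≤ boundD M b₁ b₂ δ t)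
    (hgm : Measurable ((Ioo 0 1).indicator g))
    (hc : ∀ n, 1 ≤ n → ∀ t ∈ Ioo (0 : ℝ) 1, |score c n t| ≤ boundB M b₁ b₂ t)
    {κ : ℕ → Measure ℝ} [∀ n, IsProbabilityMeasure (κ n)] (hκ : IsVanishingNoise κ)
    (happrox : ∀ (f : ℝ → ℝ) (q : ℝ), 1 < q → Measurable f → Integrable f →
      MemLp f (ENNReal.ofReal q) → ∀ᵐ ω ∂P, IsStablyApproximable κ (fun i => ξ i ω) f) :
    ∀ᵐ ω ∂P, Tendsto (fun n => (∫ u in Ioo 0 1, (Ioo 0 1).indicator g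
      (leftInv (cdf (empMeasure n (fun i => ξ i ω) ∗ κ n)) u) * score c n u) - centerMu g c n)
      atTop (𝓝 0) := by
  obtain ⟨η, s, q, hη, hs, hq, hsq, hs₁, hs₂⟩ := exists_exponents hb₁ hb₂ hδ
  have hq0 := zero_lt_one.trans hq
  have hgq := memLp_indicator_of_abs_le_boundD hg hgm (by nlinarith) (by nlinarith) hq0 hsq
  have hgi := integrable_indicator_of_abs_le_boundD hb₁ hb₂ hδ hg hgm
  filter_upwards [ae_isTypicalPath hmeas hind hlaw hη, happrox _ q hq hgm hgi hgq,
    happrox (weight s) q hq measurable_weight (integrable_weight hs) (memLp_weight hq0 hsq)]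
    with ω hω hgω hwω
  exact tendsto_setIntegral_comp_leftInv_mul_score_sub_centerMu hb₁ hb₂ hη.le hg hgm hc hs₁ hs₂
    hs hκ hω hgω hwω

theorem ae_tendsto_statT_sub_centerMu
    (hmeas : ∀ i, Measurable (ξ i)) (hind : iIndepFun ξ P)
    (hlaw : ∀ i, P.map (ξ i) = volume.restrict (Ioo 0 1)) (hb₁ : 0 ≤ b₁) (hb₂ : 0 ≤ b₂)
    (hδ : 0 < δ) (hg : ∀ t ∈ Ioo (0 : ℝ) 1, |g t| ≤ boundD M b₁ b₂ δ t)
    (hgm : Measurable ((Ioo 0 1).indicator g))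
    (hc : ∀ n, 1 ≤ n → ∀ t ∈ Ioo (0 : ℝ) 1, |score c n t| ≤ boundB M b₁ b₂ t)
    {k : ℝ → ℝ} (hk0 : ∀ x, 0 ≤ k x) (hk1 : ∫ x, k x = 1)
    {A : ℝ} (hkA : ∀ x, k x ≤ A) (hk00 : kernelDF k 0 ∈ Ioo 0 1) {b : ℕ → ℝ}
    (hb : ∀ n, 1 ≤ n → 0 < b n) (hb0 : Tendsto b atTop (𝓝 0))
    (hbO : (fun n => (b n)⁻¹) =O[atTop] fun n : ℕ => (n : ℝ)) :
    ∀ᵐ ω ∂P, Tendsto (fun n => statT g k c (b n) n (fun i => ξ i ω) - centerMu g c n)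
      atTop (𝓝 0) := by
  have := fun n => isProbabilityMeasure_kernelLaw hk0 hk1 (b n)
  obtain ⟨C, hC, hkC⟩ :=
    exists_eventually_kernelLaw_le_smul_volume ((hk0 0).trans (hkA 0)) hkA hb hbO
  filter_upwards [ae_tendsto_setIntegral_comp_leftInv_mul_score_sub_centerMu hmeas hind hlaw hb₁
    hb₂ hδ hg hgm hc (isVanishingNoise_kernelLaw hk0 hk1 hk00 hb hb0) fun f q hq hf hfi hfq =>
      ae_isStablyApproximable_of_le_smul_volume hmeas hind hlaw Measure.restrict_le_self hC hkC hq
        hf hfi hfq] with ω hω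
  refine hω.congr' ?_
  filter_upwards [eventually_ge_atTop 1] with n hn
  have : NeZero n := ⟨Nat.one_le_iff_ne_zero.1 hn⟩
  simp only [statT, integrandT, kernelEst_eq_cdf hk0 hk1 (hb n hn)]

theorem ae_tendsto_statOrder_sub_centerMu
    (hmeas : ∀ i, Measurable (ξ i)) (hind : iIndepFun ξ P)
    (hlaw : ∀ i, P.map (ξ i) = volume.restrict (Ioo 0 1)) (hb₁ : 0 ≤ b₁) (hb₂ : 0 ≤ b₂)
    (hδ : 0 < δ) (hg : ∀ t ∈ Ioo (0 : ℝ) 1, |g t| ≤ boundD M b₁ b₂ δ t)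
    (hgm : Measurable ((Ioo 0 1).indicator g))
    (hc : ∀ n, 1 ≤ n → ∀ t ∈ Ioo (0 : ℝ) 1, |score c n t| ≤ boundB M b₁ b₂ t) :
    ∀ᵐ ω ∂P, Tendsto (fun n => statOrder g c n (fun i => ξ i ω) - centerMu g c n)
      atTop (𝓝 0) := by
  have hmem (i : ℕ) : ∀ᵐ ω ∂P, ξ i ω ∈ Ioo (0 : ℝ) 1 :=
    ae_of_ae_map (hmeas i).aemeasurable (hlaw i ▸ ae_restrict_mem measurableSet_Ioo)
  filter_upwards [ae_all_iff.2 hmem, ae_tendsto_setIntegral_comp_leftInv_mul_score_sub_centerMu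
    hmeas hind hlaw hb₁ hb₂ hδ hg hgm hc isVanishingNoise_dirac_zero fun f _ _ hf hfi _ =>
      ae_isStablyApproximable_dirac_zero hmeas hind hlaw Measure.restrict_le_self hf hfi]
    with ω hmemω hω
  refine hω.congr' ?_
  filter_upwards [eventually_gt_atTop 0] with n hn
  have hindicator : statOrder g c n (fun i => ξ i ω) =
      statOrder ((Ioo 0 1).indicator g) c n fun i => ξ i ω := by
    simp only [statOrder, orderStat, indicator_of_mem (hmemω _)]
  rw [hindicator, statOrder_eq_setIntegral _ _ _ hn, Measure.conv_dirac_zero]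

end Statistics

end LStat

end

open LStat in
theorem theorem3_general
    {Ω : Type*} [MeasurableSpace Ω] (P : Measure Ω)
    (ξ : ℕ → Ω → ℝ) (hξ_meas : ∀ i, Measurable (ξ i)) (hξ_indep : iIndepFun ξ P)
    (hξ_unif : ∀ i, pdf.IsUniform (ξ i) (Ioo 0 1) P volume)
    (k : ℝ → ℝ) (hk_nonneg : ∀ x, 0 ≤ k x) (hk_one : ∫ x, k x = 1)
    (hk_bdd : ∃ A, ∀ x, k x ≤ A) (hk_zero : kernelDF k 0 ∈ Ioo 0 1)
    (b : ℕ → ℝ) (hb_pos : ∀ n, 1 ≤ n → 0 < b n) (hb_zero : Tendsto b atTop (𝓝 0))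
    (hb_inv : (fun n => (b n)⁻¹) =O[atTop] fun n : ℕ => (n : ℝ))
    (g : ℝ → ℝ) (hg_meas : Measurable ((Ioo 0 1).indicator g)) (c : ℕ → ℕ → ℝ)
    (M b₁ b₂ δ : ℝ) (hb₁ : 0 ≤ b₁) (hb₂ : 0 ≤ b₂) (hδ : 0 < δ)
    (hg : ∀ t ∈ Ioo (0 : ℝ) 1, |g t| ≤ boundD M b₁ b₂ δ t)
    (hc : ∀ n, 1 ≤ n → ∀ t ∈ Ioo (0 : ℝ) 1, |score c n t| ≤ boundB M b₁ b₂ t) :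
    (∀ n, 1 ≤ n → IntegrableOn (fun t => g t * score c n t) (Ioo 0 1)) ∧
    (∀ᵐ ω ∂P, ∀ n, 1 ≤ n →
      IntegrableOn (integrandT g k c (b n) n (fun i => ξ i ω)) (Ioo 0 1)) ∧
    (∀ᵐ ω ∂P, Tendsto (fun n => statT g k c (b n) n (fun i => ξ i ω) - centerMu g c n)
      atTop (𝓝 0)) ∧
    (∀ᵐ ω ∂P, Tendsto (fun n => statOrder g c n (fun i => ξ i ω) - centerMu g c n)
      atTop (𝓝 0)) := by
  obtain ⟨A, hA⟩ := hk_bdd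
  have hlaw (i : ℕ) : P.map (ξ i) = volume.restrict (Ioo 0 1) := by
    rw [hξ_unif i, ProbabilityTheory.cond]
    simp
  have hgi := integrable_indicator_of_abs_le_boundD hb₁ hb₂ hδ hg hg_meas
  refine ⟨fun n _ => ?_, ?_, ?_, ?_⟩
  · exact integrableOn_mul_score ((integrable_indicator_iff measurableSet_Ioo).1 hgi) c n
  · exact Eventually.of_forall fun ω n hn =>
      integrableOn_integrandT hk_nonneg hk_one hA (hb_pos n hn) hgi c hn _
  · exact ae_tendsto_statT_sub_centerMu hξ_meas hξ_indep hlaw hb₁ hb₂ hδ hg hg_meas hc hk_nonneg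
      hk_one hA hk_zero hb_pos hb_zero hb_inv
  · exact ae_tendsto_statOrder_sub_centerMu hξ_meas hξ_indep hlaw hb₁ hb₂ hδ hg hg_meas hc

theorem theorem3
    {Ω : Type*} [MeasurableSpace Ω] (P : Measure Ω) [IsProbabilityMeasure P]
    (ξ : ℕ → Ω → ℝ) (hξ_meas : ∀ i, Measurable (ξ i)) (hξ_indep : iIndepFun ξ P)
    (hξ_unif : ∀ i, pdf.IsUniform (ξ i) (Ioo 0 1) P volume)
    (k : ℝ → ℝ) (hk : LStat.IsKernel k)
    (b : ℕ → ℝ) (hb : LStat.IsBandwidth b)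
    (g : ℝ → ℝ) (hg : LStat.IsClassG g)
    (c : ℕ → ℕ → ℝ)
    (J : Ioo (0 : ℝ) 1 → ℝ) (hJ : Measurable J)
    (M b₁ b₂ δ : ℝ) (hM : 0 < M) (hb₁ : 0 < b₁) (hb₂ : 0 < b₂) (hδ : 0 < δ)
    (hbound : LStat.IsBounded M b₁ b₂ δ g hg c J) :
    (∀ n, 1 ≤ n → IntegrableOn (fun t => g t * LStat.score c n t) (Ioo 0 1)) ∧
    (∀ᵐ ω ∂P, ∀ n, 1 ≤ n →
      IntegrableOn (LStat.integrandT g k c (b n) n (fun i => ξ i ω)) (Ioo 0 1)) ∧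
    (∀ᵐ ω ∂P, Tendsto
      (fun n => LStat.statT g k c (b n) n (fun i => ξ i ω) - LStat.centerMu g c n)
      atTop (𝓝 0)) ∧
    (∀ᵐ ω ∂P, Tendsto
      (fun n => LStat.statOrder g c n (fun i => ξ i ω) - LStat.centerMu g c n)
      atTop (𝓝 0)) := by
  exact theorem3_general P ξ hξ_meas hξ_indep hξ_unif k hk.nonneg hk.integral_eq_one hk.bounded
    hk.kernelDF_zero_mem_Ioo b hb.pos hb.tendsto_zero hb.isBigO_inv g
    hg.measurable_indicator c M b₁ b₂ δ hb₁.le hb₂.le hδ hbound.g_le hbound.score_le
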